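/- Let $\mathbb F$ be an algebraically closed field, let $N,p,m,r$ be integers with $0\le p\le N-2$, $m\ge 0$ and $r\ge 1$, let $\sigma_0,\dots,\sigma_{N-1}\in\mathbb F$, let $\xi_1,\dots,\xi_N\in(\mathbb F\cup\{\infty\})\setminus\{0\}$, and let $\beta_0,\dots,\beta_N\in\mathbb F\setminus\{0\}$. With the convention $\lambda/\infty=0$, put $g_i(\lambda)=\beta_i(1-\lambda/\xi_i)$, $h_j(\lambda)=\lambda-\sigma_j$ and $$b_0=\frac1{\beta_0},\qquad b_i(\lambda)=\frac1{\beta_0}\prod_{k=1}^{i}\frac{\lambda-\sigma_{k-1}}{\beta_k(1-\lambda/\xi_k)}\quad(1\le i\le N).$$ Let $\widetilde D_0,\dots,\widetilde D_p\in\mathbb F^{m\times m}$, $\widetilde L_{p+1},\dots,\widetilde L_N\in\mathbb F^{m\times r}$, $\widetilde U\in\mathbb F^{m\times r}$, and let $$\widetilde Q_N(\lambda)=\sum_{i=0}^{p}b_i(\lambda)\widetilde D_i+\sum_{i=p+1}^{N}b_i(\lambda)\widetilde L_i\widetilde U^T\in\mathbb F(\lambda)^{m\times m},\qquad \widetilde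 L_N(\lambda)=\begin{bmatrix}\widetilde M_N(\lambda)\\ \widetilde K_N(\lambda)\end{bmatrix},$$ where $$\widetilde M_N=\begin{bmatrix}\frac{g_N}{\beta_N}\widetilde D_0&\cdots&\frac{g_N}{\beta_N}\widetilde D_p&\frac{g_N}{\beta_N}\widetilde L_{p+1}&\cdots&\frac{g_N}{\beta_N}\widetilde L_{N-2}&\frac{g_N}{\beta_N}\widetilde L_{N-1}+\frac{h_{N-1}}{\beta_N}\widetilde L_N\end{bmatrix}$$ and, with block columns numbered $0,\dots,N-1$ as in $\widetilde M_N$, $\widetilde K_N$ is the block bidiagonal pencil with block rows $j=1,\dots,N-1$ whose only nonzero blocks are those in block columns $j-1$ and $j$, namely $-h_{j-1}I_m,\ g_jI_m$ for $j\le p$; $-h_p\widetilde U^T,\ g_{p+1}I_r$ for $j=p+1$; and $-h_{j-1}I_r,\ g_jI_r$ for $j\ge p+2$. Let $\mathcal P_N$ be the set of finite elements, and $i_N$ the number of infinite elements, of the list $(\xi_1,\dots,\xi_N)$. Definitions. A rational matrix is defined at $\lambda_0\in\mathbb F$ if none of its entries has a pole there; it has full row rank in $\Omega\subseteq\mathbb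 F$ if, at each point of $\Omega$, it is defined and its value has full row rank; a square one is regular at $\lambda_0$ if it is defined there with invertible value. For an integer $g$, $\operatorname{rev}_gG(\lambda)=\lambda^gG(1/\lambda)$. A block full rank pencil is a matrix polynomial of degree at most one with a partition $L=\begin{bmatrix}M&K_2^T\\K_1&0\end{bmatrix}$ where $K_1,K_2$ have full row normal rank (possibly $K_1$ or $K_2$ is empty; with $K_2$ empty, $L$ has only one block column). It is associated with a rational matrix $G$ in a nonempty $\Omega\subseteq\mathbb F$ if there are rational matrices $N_1,N_2$ such that, for $i=1,2$: $N_i$ has full row normal rank and the same number of columns as $K_i$, the numbers of rows of $K_i$ and $N_i$ add up to this number of columns, $K_iN_i^T=0$, and $K_i$ and $N_i$ have full row rank in $\Omega$; and $G=N_2MN_1^T$. A pencil $L\in\mathbb F[\lambda]^{q\times t}$ is a linearization of $G\in\mathbb F(\lambda)^{k\times l}$ with empty state matrix at $\lambda_0\in\mathbb F$ if there are integers $s_1,s_2\ge0$ with $s_1-s_2=q-k=t-l$ and square rational matrices $R_1,R_2$ regular at $\lambda_0$ with $R_1\operatorname{diag}(G,I_{s_1})R_2=\operatorname{diag}(L,I_{s_2})$;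 it is one in a nonempty set $\Omega\subseteq\mathbb F$ if it is one at each point of $\Omega$. It is a linearization of $G$ with empty state matrix at $\infty$ of grade $g$ if there are $s_1,s_2\ge0$ with $s_1-s_2=q-k=t-l$ and square rational matrices $R_1,R_2$ regular at $0$ with $R_1\operatorname{diag}(\operatorname{rev}_gG,I_{s_1})R_2=\operatorname{diag}(\operatorname{rev}_\ell L,I_{s_2})$, where $\ell=\deg L$. Theorem. (a) $\widetilde L_N(\lambda)$, partitioned as $\begin{bmatrix}\widetilde M_N\\ \widetilde K_N\end{bmatrix}$ (so $M=\widetilde M_N$, $K_1=\widetilde K_N$, $K_2$ empty), is a block full rank pencil with only one block column associated with $\widetilde Q_N(\lambda)$ in $\mathbb F\setminus\mathcal P_N$. (b) $\widetilde L_N(\lambda)$ is a linearization with empty state matrix of $\widetilde Q_N(\lambda)$ in $\mathbb F\setminus\mathcal P_N$. (c) If, in addition, $\xi_{p+1},\dots,\xi_{N-1}$ are all finite, then $\widetilde L_N(\lambda)$ is a linearization with empty state matrix of $\widetilde Q_N(\lambda)$ at $\infty$ of grade $i_N$. -/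

import Mathlib

open Polynomial

namespace NLEIGS

noncomputable section

variable {F : Type*} [Field F]

/-! ### Rational matrices: values at points, local regularity, reversals -/

/-- A polynomial matrix, seen as a rational matrix. -/
def toRat {ρ γ : Type*} (P : Matrix ρ γ F[X]) : Matrix ρ γ (RatFunc F) :=
  P.map (algebraMap F[X] (RatFunc F))

/-- `R` is defined (bounded) at the finite point `x`: no entry has a pole there.
The denominator of a `RatFunc` is that of its reduced form. -/
def DefinedAt {ρ γ : Type*} (R : Matrix ρ γ (RatFunc F)) (x : F) : Prop :=
  ∀ i j, (R i j).denom.eval x ≠ 0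

/-- The value `R(x)`; meaningful where `R` is defined. -/
def evalAt {ρ γ : Type*} (R : Matrix ρ γ (RatFunc F)) (x : F) : Matrix ρ γ F :=
  R.map (RatFunc.eval (RingHom.id F) x)

/-- A square rational matrix is regular at `x`: it is defined there with invertible value. -/
def RegularAt {ρ : Type*} [Fintype ρ] [DecidableEq ρ] (R : Matrix ρ ρ (RatFunc F)) (x : F) :
    Prop :=
  DefinedAt R x ∧ (evalAt R x).det ≠ 0

/-- Full row normal rank: the rank over the field of rational functions is the number of rows. -/
def HasFullRowNormalRank {ρ γ : Type*} [Fintype ρ] [Fintype γ] (R : Matrix ρ γ (RatFunc F)) :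
    Prop :=
  R.rank = Fintype.card ρ

/-- Full row rank in a set `Ω` of finite points: `R` is defined at each point of `Ω`, and its value
there has full row rank. -/
def HasFullRowRankIn {ρ γ : Type*} [Fintype ρ] [Fintype γ] (R : Matrix ρ γ (RatFunc F))
    (Ω : Set F) : Prop :=
  ∀ x ∈ Ω, DefinedAt R x ∧ (evalAt R x).rank = Fintype.card ρ

/-- The substitution `λ ↦ 1/λ` in a rational function. -/
def substInv (f : RatFunc F) : RatFunc F :=
  RatFunc.eval (algebraMap F (RatFunc F)) (RatFunc.X : RatFunc F)⁻¹ f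

/-- The `g`-reversal `λ ^ g * R(1/λ)`, for an integer `g`. -/
def revMat {ρ γ : Type*} (g : ℤ) (R : Matrix ρ γ (RatFunc F)) : Matrix ρ γ (RatFunc F) :=
  R.map fun f => (RatFunc.X : RatFunc F) ^ g * substInv f

/-- The degree of a polynomial matrix (`0` for the zero matrix). -/
def matDegree {ρ γ : Type*} [Fintype ρ] [Fintype γ] (P : Matrix ρ γ F[X]) : ℕ :=
  Finset.univ.sup fun i => Finset.univ.sup fun j => (P i j).natDegree

/-- Linear polynomial matrices (matrix pencils). -/
def IsPencil {ρ γ : Type*} (P : Matrix ρ γ F[X]) : Prop :=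
  ∀ i j, (P i j).natDegree ≤ 1

/-! ### Linear polynomial system matrices and local linearizations -/

/-- The polynomial system matrix with state matrix `A`. -/
def systemMatrix {n q r : Type*} (A : Matrix n n F[X]) (B : Matrix n r F[X]) (C : Matrix q n F[X])
    (D : Matrix q r F[X]) : Matrix (n ⊕ q) (n ⊕ r) F[X] :=
  Matrix.fromBlocks A B (-C) D

/-- The blocks define a linear polynomial system matrix: degree at most one and `A` nonsingular. -/
def IsLinearSystemMatrix {n q r : Type*} [Fintype n] [DecidableEq n]
    (A : Matrix n n F[X]) (B : Matrix n r F[X]) (C : Matrix q n F[X]) (D : Matrix q r F[X]) :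
    Prop :=
  IsPencil (systemMatrix A B C D) ∧ A.det ≠ 0

/-- The transfer function matrix `D + C A⁻¹ B`. -/
def transferFunction {n q r : Type*} [Fintype n] [DecidableEq n]
    (A : Matrix n n F[X]) (B : Matrix n r F[X]) (C : Matrix q n F[X]) (D : Matrix q r F[X]) :
    Matrix q r (RatFunc F) :=
  toRat D + toRat C * (toRat A)⁻¹ * toRat B

/-- Minimality at `x` of a system matrix with blocks `A`, `B`, `C`. It holds automatically when
the state matrix is empty. -/
def IsMinimalAt {n q r : Type*} [Fintype n] [Fintype q] [Fintype r]
    (A : Matrix n n (RatFunc F)) (B : Matrix n r (RatFunc F)) (C : Matrix q n (RatFunc F))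
    (x : F) : Prop :=
  (Matrix.fromRows (evalAt A x) (evalAt C x)).rank = Fintype.card n ∧
    (Matrix.fromCols (evalAt A x) (evalAt B x)).rank = Fintype.card n

/-- `diag(G, I_s)`. -/
def padOne {p m : Type*} (G : Matrix p m (RatFunc F)) (s : ℕ) :
    Matrix (p ⊕ Fin s) (m ⊕ Fin s) (RatFunc F) :=
  Matrix.fromBlocks G 0 0 1

/-- There are `s₁, s₂ ≥ 0` such that `diag(G, I_{s₁})` and `diag(H, I_{s₂})` have the same size and
are equivalent at `x`. The bijections `e₁`, `e₂` only identify the two index sets (so they carry the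
size condition `s₁ - s₂ = q - p = r - m`); which ones are taken is immaterial, because permutation
matrices are regular at every point. -/
def IsExtendedEquivalentAt {p m q r : Type*} [Fintype p] [Fintype m] [DecidableEq p]
    [DecidableEq m] (G : Matrix p m (RatFunc F)) (H : Matrix q r (RatFunc F)) (x : F) : Prop :=
  ∃ (s₁ s₂ : ℕ) (e₁ : p ⊕ Fin s₁ ≃ q ⊕ Fin s₂) (e₂ : m ⊕ Fin s₁ ≃ r ⊕ Fin s₂)
    (R₁ : Matrix (p ⊕ Fin s₁) (p ⊕ Fin s₁) (RatFunc F))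
    (R₂ : Matrix (m ⊕ Fin s₁) (m ⊕ Fin s₁) (RatFunc F)),
    RegularAt R₁ x ∧ RegularAt R₂ x ∧
      R₁ * padOne G s₁ * R₂ = (padOne H s₂).submatrix e₁ e₂

/-- The linear polynomial system matrix `[A B; -C D]`, with state matrix `A`, is a linearization of
`G` at the finite point `x`. -/
def IsLinearizationAt {n q r p m : Type*} [Fintype n] [DecidableEq n] [Fintype q] [Fintype r]
    [Fintype p] [Fintype m] [DecidableEq p] [DecidableEq m]
    (A : Matrix n n F[X]) (B : Matrix n r F[X]) (C : Matrix q n F[X]) (D : Matrix q r F[X])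
    (G : Matrix p m (RatFunc F)) (x : F) : Prop :=
  IsLinearSystemMatrix A B C D ∧ IsMinimalAt (toRat A) (toRat B) (toRat C) x ∧
    IsExtendedEquivalentAt G (transferFunction A B C D) x

/-- Linearization in a nonempty set of finite points. -/
def IsLinearizationIn {n q r p m : Type*} [Fintype n] [DecidableEq n] [Fintype q] [Fintype r]
    [Fintype p] [Fintype m] [DecidableEq p] [DecidableEq m]
    (A : Matrix n n F[X]) (B : Matrix n r F[X]) (C : Matrix q n F[X]) (D : Matrix q r F[X])
    (G : Matrix p m (RatFunc F)) (Ω : Set F) : Prop :=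
  Ω.Nonempty ∧ ∀ x ∈ Ω, IsLinearizationAt A B C D G x

/-- Linearization at infinity of grade `g`. With `ℓ` the degree of the whole system matrix, the
reversed system matrix is minimal at `0`, and the `g`-reversal of `G` and the `ℓ`-reversal of the
transfer function matrix become equivalent at `0` after extension by identity blocks. -/
def IsLinearizationAtInfinity {n q r p m : Type*} [Fintype n] [DecidableEq n] [Fintype q]
    [Fintype r] [Fintype p] [Fintype m] [DecidableEq p] [DecidableEq m]
    (A : Matrix n n F[X]) (B : Matrix n r F[X]) (C : Matrix q n F[X]) (D : Matrix q r F[X])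
    (G : Matrix p m (RatFunc F)) (g : ℤ) : Prop :=
  IsLinearSystemMatrix A B C D ∧
    IsMinimalAt (revMat (matDegree (systemMatrix A B C D)) (toRat A))
      (revMat (matDegree (systemMatrix A B C D)) (toRat B))
      (revMat (matDegree (systemMatrix A B C D)) (toRat C)) 0 ∧
    IsExtendedEquivalentAt (revMat g G)
      (revMat (matDegree (systemMatrix A B C D)) (transferFunction A B C D)) 0

/-- `L` is a linearization of `G` in `Ω` with empty state matrix. -/
def IsLinearizationEmptyStateIn {q r p m : Type*} [Fintype q] [Fintype r]
    [Fintype p] [Fintype m] [DecidableEq p] [DecidableEq m]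
    (L : Matrix q r F[X]) (G : Matrix p m (RatFunc F)) (Ω : Set F) : Prop :=
  IsLinearizationIn (0 : Matrix (Fin 0) (Fin 0) F[X]) (0 : Matrix (Fin 0) r F[X])
    (0 : Matrix q (Fin 0) F[X]) L G Ω

/-- `L` is a linearization of `G` at infinity of grade `g` with empty state matrix. -/
def IsLinearizationEmptyStateAtInfinity {q r p m : Type*} [Fintype q] [Fintype r]
    [Fintype p] [Fintype m] [DecidableEq p] [DecidableEq m]
    (L : Matrix q r F[X]) (G : Matrix p m (RatFunc F)) (g : ℤ) : Prop :=
  IsLinearizationAtInfinity (0 : Matrix (Fin 0) (Fin 0) F[X]) (0 : Matrix (Fin 0) r F[X])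
    (0 : Matrix q (Fin 0) F[X]) L G g

/-! ### Block full rank pencils -/

/-- `L`, partitioned by `er` and `ec` as `[M K₂ᵀ; K₁ 0]`, is a block full rank pencil: it is linear
and `K₁`, `K₂` have full row normal rank. `K₁` or `K₂` may be empty. -/
def IsBlockFullRankPencil {ρ γ a b k₁ k₂ : Type*} [Fintype a] [Fintype b] [Fintype k₁] [Fintype k₂]
    (L : Matrix ρ γ F[X]) (er : ρ ≃ a ⊕ k₁) (ec : γ ≃ b ⊕ k₂)
    (M : Matrix a b F[X]) (K₁ : Matrix k₁ b F[X]) (K₂ : Matrix k₂ a F[X]) : Prop :=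
  L.reindex er ec = Matrix.fromBlocks M K₂.transpose K₁ 0 ∧ IsPencil L ∧
    HasFullRowNormalRank (toRat K₁) ∧ HasFullRowNormalRank (toRat K₂)

/-- `N` is a rational basis dual to (the rational basis) `K`: both have full row normal rank, the
numbers of rows add up to the number of columns, and `K Nᵀ = 0`. If `K` has no rows, this says that
`N` is a square regular rational matrix. -/
def AreDualRationalBases {k n b : Type*} [Fintype k] [Fintype n] [Fintype b]
    (K : Matrix k b (RatFunc F)) (N : Matrix n b (RatFunc F)) : Prop :=
  HasFullRowNormalRank K ∧ HasFullRowNormalRank N ∧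
    Fintype.card k + Fintype.card n = Fintype.card b ∧ K * N.transpose = 0

/-- `L`, with the given partition, is a block full rank pencil associated with `G` in the nonempty
set `Ω`: there are rational bases `N₁`, `N₂` dual to `K₁`, `K₂` such that `K₁`, `K₂`, `N₁`, `N₂`
have full row rank in `Ω` and `G = N₂ M N₁ᵀ`. -/
def IsBlockFullRankPencilAssociatedIn {ρ γ a b k₁ k₂ n₁ n₂ : Type*} [Fintype a] [Fintype b]
    [Fintype k₁] [Fintype k₂] [Fintype n₁] [Fintype n₂]
    (L : Matrix ρ γ F[X]) (er : ρ ≃ a ⊕ k₁) (ec : γ ≃ b ⊕ k₂)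
    (M : Matrix a b F[X]) (K₁ : Matrix k₁ b F[X]) (K₂ : Matrix k₂ a F[X])
    (G : Matrix n₂ n₁ (RatFunc F)) (Ω : Set F) : Prop :=
  IsBlockFullRankPencil L er ec M K₁ K₂ ∧ Ω.Nonempty ∧
    ∃ (N₁ : Matrix n₁ b (RatFunc F)) (N₂ : Matrix n₂ a (RatFunc F)),
      AreDualRationalBases (toRat K₁) N₁ ∧ AreDualRationalBases (toRat K₂) N₂ ∧
      HasFullRowRankIn (toRat K₁) Ω ∧ HasFullRowRankIn (toRat K₂) Ω ∧
      HasFullRowRankIn N₁ Ω ∧ HasFullRowRankIn N₂ Ω ∧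
      G = N₂ * toRat M * N₁.transpose

/-! ### The NLEIGS scalar functions, rational matrix and pencil -/

/-- `1 - λ/ξ`, which is `1` for `ξ = ∞` (and is used for `ξ ≠ 0` only). -/
def poleFactor : OnePoint F → F[X]
  | OnePoint.infty => 1
  | OnePoint.some x => 1 - C x⁻¹ * X

/-- `g_i(λ) = β_i (1 - λ/ξ_i)`. -/
def gFun (ξ : ℕ → OnePoint F) (β : ℕ → F) (i : ℕ) : F[X] := C (β i) * poleFactor (ξ i)

/-- `h_j(λ) = λ - σ_j`. -/
def hFun (σ : ℕ → F) (j : ℕ) : F[X] := X - C (σ j)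

/-- `b_i(λ) = (1/β₀) ∏_{k=1}^{i} (λ - σ_{k-1}) / (β_k (1 - λ/ξ_k))`. -/
def bFun (σ : ℕ → F) (ξ : ℕ → OnePoint F) (β : ℕ → F) (i : ℕ) : RatFunc F :=
  (1 / algebraMap F (RatFunc F) (β 0)) *
    ∏ k ∈ Finset.Icc 1 i,
      algebraMap F[X] (RatFunc F) (hFun σ (k - 1)) / algebraMap F[X] (RatFunc F) (gFun ξ β k)

/-- `𝒫_N`: the finite elements of the list `ξ_1, …, ξ_N`. -/
def finitePoles (N : ℕ) (ξ : ℕ → OnePoint F) : Set F :=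
  {x | ∃ k, 1 ≤ k ∧ k ≤ N ∧ ξ k = OnePoint.some x}

open Classical in
/-- `i_N`: the number of infinite elements in the list `ξ_1, …, ξ_N`. -/
def numInfinitePoles (N : ℕ) (ξ : ℕ → OnePoint F) : ℕ :=
  ((Finset.Icc 1 N).filter fun k => ξ k = OnePoint.infty).card

/-- The low rank rational matrix
`Q̃_N = ∑_{i=0}^{p} b_i D̃_i + ∑_{i=p+1}^{N} b_i L̃_i Ũᵀ`. -/
def lowRankQ (N p m r : ℕ) (σ : ℕ → F) (ξ : ℕ → OnePoint F) (β : ℕ → F)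
    (D : ℕ → Matrix (Fin m) (Fin m) F) (Lt : ℕ → Matrix (Fin m) (Fin r) F)
    (U : Matrix (Fin m) (Fin r) F) : Matrix (Fin m) (Fin m) (RatFunc F) :=
  (∑ i ∈ Finset.Icc 0 p, bFun σ ξ β i • (D i).map (algebraMap F (RatFunc F))) +
    ∑ i ∈ Finset.Icc (p + 1) N,
      bFun σ ξ β i • (Lt i * U.transpose).map (algebraMap F (RatFunc F))

/-- Column index of the pencil: block columns `0, …, p` of width `m`, then block columns
`p+1, …, N-1` of width `r`; the pair `(k, _)` of the second kind is in block column `p+1+k`. -/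
abbrev ColIdx (N p m r : ℕ) : Type := (Fin (p + 1) × Fin m) ⊕ (Fin (N - 1 - p) × Fin r)

/-- Row index of `K̃_N`: block rows `1, …, p` of height `m`, then block rows `p+1, …, N-1` of
height `r`; block row `j` is the one that contains `-h_{j-1}` and `g_j`. The pair `(j, _)` of the
first kind is in block row `j+1`, the pair `(k, _)` of the second kind in block row `p+1+k`. -/
abbrev RowIdx (N p m r : ℕ) : Type := (Fin p × Fin m) ⊕ (Fin (N - 1 - p) × Fin r)

/-- `M̃_N`, the block row with blocks `(g_N/β_N) D̃_i` for `i ≤ p`, `(g_N/β_N) L̃_i` for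
`p < i < N-1`, and `(g_N/β_N) L̃_{N-1} + (h_{N-1}/β_N) L̃_N`. -/
def lowRankM (N p m r : ℕ) (σ : ℕ → F) (ξ : ℕ → OnePoint F) (β : ℕ → F)
    (D : ℕ → Matrix (Fin m) (Fin m) F) (Lt : ℕ → Matrix (Fin m) (Fin r) F) :
    Matrix (Fin m) (ColIdx N p m r) F[X] :=
  Matrix.fromCols
    (Matrix.of fun a c => C (β N)⁻¹ * gFun ξ β N * C (D c.1 a c.2))
    (Matrix.of fun a c =>
      C (β N)⁻¹ * gFun ξ β N * C (Lt (p + 1 + c.1) a c.2) +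
        if p + 1 + (c.1 : ℕ) = N - 1 then C (β N)⁻¹ * hFun σ (N - 1) * C (Lt N a c.2) else 0)

/-- `K̃_N`, the block bidiagonal pencil with block row `j` equal to
`[… -h_{j-1} I_m, g_j I_m …]` for `j ≤ p`, to `[… -h_p Ũᵀ, g_{p+1} I_r …]` for `j = p+1`, and to
`[… -h_{j-1} I_r, g_j I_r …]` for `p+1 < j ≤ N-1`. -/
def lowRankK (N p m r : ℕ) (σ : ℕ → F) (ξ : ℕ → OnePoint F) (β : ℕ → F)
    (U : Matrix (Fin m) (Fin r) F) : Matrix (RowIdx N p m r) (ColIdx N p m r) F[X] :=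
  Matrix.fromBlocks
    (Matrix.of fun a c =>
      if a.2 = c.2 then
        if (c.1 : ℕ) = a.1 then -hFun σ a.1
        else if (c.1 : ℕ) = a.1 + 1 then gFun ξ β (a.1 + 1) else 0
      else 0)
    0
    (Matrix.of fun a c =>
      if (a.1 : ℕ) = 0 ∧ (c.1 : ℕ) = p then -hFun σ p * C (U.transpose a.2 c.2) else 0)
    (Matrix.of fun a c =>
      if a.2 = c.2 then
        if (c.1 : ℕ) + 1 = a.1 then -hFun σ (p + a.1)
        else if c.1 = a.1 then gFun ξ β (p + 1 + a.1) else 0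
      else 0)

/-- The low rank NLEIGS pencil `L̃_N = [M̃_N; K̃_N]`. -/
def lowRankL (N p m r : ℕ) (σ : ℕ → F) (ξ : ℕ → OnePoint F) (β : ℕ → F)
    (D : ℕ → Matrix (Fin m) (Fin m) F) (Lt : ℕ → Matrix (Fin m) (Fin r) F)
    (U : Matrix (Fin m) (Fin r) F) :
    Matrix (Fin m ⊕ RowIdx N p m r) (ColIdx N p m r) F[X] :=
  Matrix.fromRows (lowRankM N p m r σ ξ β D Lt) (lowRankK N p m r σ ξ β U)

end

end NLEIGS

/-!
The scalars satisfy `g_{i+1} b_{i+1} = h_i b_i`, so the block column `P` with blocks `b_i I` for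
`i ≤ p` and `b_i Uᵀ` for `i > p` is annihilated by `K̃_N` (`lowRankK_mul_nullBasis`), and since
`h_{N-1} b_{N-1} = g_N b_N` also gives `M̃_N P = (g_N / β_N) Q̃_N` (`lowRankM_mul_nullBasis`).
Hence `(β_N / g_N) Pᵀ` is the dual rational basis that recovers `Q̃_N`.

Both linearization statements follow from one principle, `isExtendedEquivalentAt_fromRows`. Let `E`
be a block row such that `[E; K]` is regular at a point. If `E P = d I`, `K P = 0` and `M P = a G`,
then `[M; K] [E; K]⁻¹ = [(a / d) G, Z; 0, I]`, so `[M; K]` is equivalent to `diag(G, I)` at the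
point as soon as `a / d` has neither a zero nor a pole there. For `E` one takes the selector of a
single block column `q ≤ p`. As `K̃_N` is block bidiagonal, `[E; K]` is regular when the blocks
`-h_j` to the left of block column `q` and the blocks `g_j` to its right do not vanish
(`eq_zero_of_bidiagonal_mulVec_eq_zero`, `regularAt_blockSelector`).

* At a finite point that is not a pole, `q = 0` works, because no `g_j` vanishes there.
* At infinity, `q = p` works: the reversed `h_j` take the value `1` at `0`, and the reversed `g_j`
  are nonzero at `0` exactly when `ξ_j` is finite, which is needed for `p < j < N` only. Here
  `d = b_p(1/λ)` has a pole of order the number of infinite poles among `ξ_1, …, ξ_p`, and the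
  remaining infinite pole, if any, is `ξ_N`. This is why `a / d` is a unit exactly for the grade
  `i_N`.

Regularity at a point `x` is handled through the local ring `localRing x` of rational functions
without a pole at `x`, on which evaluation is a ring homomorphism.
-/

namespace NLEIGS

noncomputable section

variable {F : Type*} [Field F]

/-! ### The local ring of rational functions at a point -/

/-- The rational functions without a pole at `x`: the localization of `F[X]` at `X - x`, as a
subring of the field of rational functions. -/
def localRing (x : F) : Subring (RatFunc F) where
  carrier := {f | f.denom.eval x ≠ 0}
  zero_mem' := by simp
  one_mem' := by simp
  add_mem' {f g} hf hg h := by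
    have := eval_eq_zero_of_dvd_of_eval_eq_zero (RatFunc.denom_add_dvd f g) h
    rw [eval_mul] at this
    exact mul_ne_zero hf hg this
  mul_mem' {f g} hf hg h := by
    have := eval_eq_zero_of_dvd_of_eval_eq_zero (RatFunc.denom_mul_dvd f g) h
    rw [eval_mul] at this
    exact mul_ne_zero hf hg this
  neg_mem' {f} hf h := by
    have h1 : (-f).denom ∣ f.denom := by
      have := RatFunc.denom_mul_dvd (-1) f
      have h2 : (-1 : RatFunc F).denom = 1 := by
        simpa using RatFunc.denom_algebraMap (-1 : F[X])
      simpa [h2] using this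
    exact hf (eval_eq_zero_of_dvd_of_eval_eq_zero h1 h)

/-- Evaluation at `x`, a ring homomorphism on the rational functions without a pole at `x`. -/
def localEval (x : F) : localRing x →+* F where
  toFun f := RatFunc.eval (RingHom.id F) x f
  map_zero' := RatFunc.eval_zero _ _
  map_one' := RatFunc.eval_one _ _
  map_add' f g := RatFunc.eval_add _ _ f.2 g.2
  map_mul' f g := RatFunc.eval_mul _ _ f.2 g.2

lemma algebraMap_mem_localRing (x : F) (P : F[X]) :
    algebraMap F[X] (RatFunc F) P ∈ localRing x := by
  change (RatFunc.denom _).eval x ≠ 0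
  simp

lemma inv_mem_localRing {x : F} {f : RatFunc F}
    (hf : RatFunc.eval (RingHom.id F) x f ≠ 0) : f⁻¹ ∈ localRing x := by
  have h0 : f ≠ 0 := by
    rintro rfl
    simp at hf
  intro h
  have hn : f.num.eval x = 0 :=
    eval_eq_zero_of_dvd_of_eval_eq_zero (RatFunc.denom_inv_dvd h0) h
  apply hf
  rw [RatFunc.eval, eval₂_id, hn, zero_div]

lemma isUnit_of_localEval_ne_zero {x : F} {f : localRing x} (hf : localEval x f ≠ 0) :
    IsUnit f := by
  have h0 : (f : RatFunc F) ≠ 0 := by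
    intro h
    apply hf
    change RatFunc.eval (RingHom.id F) x f = 0
    simp [h]
  exact IsUnit.of_mul_eq_one ⟨_, inv_mem_localRing hf⟩ (Subtype.ext (mul_inv_cancel₀ h0))

/-- `f` is a unit of the local ring at `x`: it has neither a pole nor a zero there. -/
def IsUnitAt (f : RatFunc F) (x : F) : Prop :=
  f ∈ localRing x ∧ RatFunc.eval (RingHom.id F) x f ≠ 0

namespace IsUnitAt

variable {f g : RatFunc F} {x : F}

lemma ne_zero (hf : IsUnitAt f x) : f ≠ 0 := by
  rintro rfl
  exact hf.2 (RatFunc.eval_zero _ _)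

lemma mul (hf : IsUnitAt f x) (hg : IsUnitAt g x) : IsUnitAt (f * g) x :=
  ⟨mul_mem hf.1 hg.1, by rw [RatFunc.eval_mul _ _ hf.1 hg.1]; exact mul_ne_zero hf.2 hg.2⟩

lemma inv (hf : IsUnitAt f x) : IsUnitAt f⁻¹ x := by
  have h1 := inv_mem_localRing hf.2
  refine ⟨h1, fun h => ?_⟩
  have h2 := RatFunc.eval_mul (RingHom.id F) x (x := f) hf.1 h1
  rw [mul_inv_cancel₀ hf.ne_zero, h, mul_zero, RatFunc.eval_one] at h2
  exact one_ne_zero h2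

lemma div (hf : IsUnitAt f x) (hg : IsUnitAt g x) : IsUnitAt (f / g) x := by
  rw [div_eq_mul_inv]
  exact hf.mul hg.inv

end IsUnitAt

lemma isUnitAt_algebraMap {x : F} {P : F[X]} (h : P.eval x ≠ 0) :
    IsUnitAt (algebraMap F[X] (RatFunc F) P) x :=
  ⟨algebraMap_mem_localRing x P, by simpa [RatFunc.eval_algebraMap] using h⟩

lemma isUnitAt_algebraMap_field {x c : F} (h : c ≠ 0) :
    IsUnitAt (algebraMap F (RatFunc F) c) x := by
  have := isUnitAt_algebraMap (x := x) (P := C c) (by simpa using h)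
  rwa [← Polynomial.algebraMap_eq, ← IsScalarTower.algebraMap_apply] at this

/-! ### Rational matrices defined at a point -/

section Matrices

variable {ρ γ κ : Type*} {x : F}

/-- A rational matrix that is defined at `x`, as a matrix over the local ring at `x`. -/
def DefinedAt.lift {R : Matrix ρ γ (RatFunc F)} (h : DefinedAt R x) :
    Matrix ρ γ (localRing x) :=
  Matrix.of fun i j => ⟨R i j, h i j⟩

lemma DefinedAt.map_lift {R : Matrix ρ γ (RatFunc F)} (h : DefinedAt R x) :
    h.lift.map (localRing x).subtype = R := rfl

lemma definedAt_map (R : Matrix ρ γ (localRing x)) :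
    DefinedAt (R.map (localRing x).subtype) x := fun i j => (R i j).2

lemma evalAt_map (R : Matrix ρ γ (localRing x)) :
    evalAt (R.map (localRing x).subtype) x = R.map (localEval x) := rfl

lemma definedAt_toRat (P : Matrix ρ γ F[X]) (x : F) : DefinedAt (toRat P) x :=
  fun i j => algebraMap_mem_localRing x (P i j)

lemma evalAt_toRat (P : Matrix ρ γ F[X]) (x : F) : evalAt (toRat P) x = P.map (eval x) := by
  ext i j
  simp [evalAt, toRat, RatFunc.eval_algebraMap]

lemma evalAt_one [DecidableEq ρ] : evalAt (1 : Matrix ρ ρ (RatFunc F)) x = 1 :=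
  Matrix.map_one _ (RatFunc.eval_zero _ _) (RatFunc.eval_one _ _)

lemma DefinedAt.mul [Fintype γ] {R : Matrix ρ γ (RatFunc F)} {S : Matrix γ κ (RatFunc F)}
    (hR : DefinedAt R x) (hS : DefinedAt S x) : DefinedAt (R * S) x := by
  have := definedAt_map (hR.lift * hS.lift)
  rwa [Matrix.map_mul, hR.map_lift, hS.map_lift] at this

lemma evalAt_mul [Fintype γ] {R : Matrix ρ γ (RatFunc F)} {S : Matrix γ κ (RatFunc F)}
    (hR : DefinedAt R x) (hS : DefinedAt S x) :
    evalAt (R * S) x = evalAt R x * evalAt S x := by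
  have := evalAt_map (hR.lift * hS.lift)
  rwa [Matrix.map_mul, Matrix.map_mul, hR.map_lift, hS.map_lift] at this

lemma DefinedAt.submatrix {R : Matrix ρ γ (RatFunc F)} (hR : DefinedAt R x) {ρ' γ' : Type*}
    (e : ρ' → ρ) (f : γ' → γ) : DefinedAt (R.submatrix e f) x := fun i j => hR (e i) (f j)

/-- The inverse of a matrix that is regular at `x` is defined at `x`. -/
lemma RegularAt.exists_inv [Fintype ρ] [DecidableEq ρ] {R : Matrix ρ ρ (RatFunc F)}
    (h : RegularAt R x) : ∃ S, DefinedAt S x ∧ R * S = 1 ∧ S * R = 1 := by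
  obtain ⟨hd, hdet⟩ := h
  have hu : IsUnit hd.lift.det := by
    apply isUnit_of_localEval_ne_zero
    rw [RingHom.map_det]
    exact hdet
  refine ⟨(hd.lift⁻¹).map (localRing x).subtype, definedAt_map _, ?_, ?_⟩
  · change hd.lift.map (localRing x).subtype * _ = 1
    rw [← Matrix.map_mul, Matrix.mul_nonsing_inv _ hu, Matrix.map_one _ rfl rfl]
  · change _ * hd.lift.map (localRing x).subtype = 1
    rw [← Matrix.map_mul, Matrix.nonsing_inv_mul _ hu, Matrix.map_one _ rfl rfl]

lemma rank_eq_card_of_mul_eq_one {K : Type*} [Field K] [Fintype ρ] [DecidableEq ρ] [Fintype γ]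
    {A : Matrix ρ γ K} {B : Matrix γ ρ K} (h : A * B = 1) : A.rank = Fintype.card ρ := by
  apply le_antisymm (Matrix.rank_le_card_height A)
  rw [← Matrix.rank_one (R := K) (n := ρ), ← h]
  exact Matrix.rank_mul_le_left A B

/-- A matrix with a right inverse has full row rank at each point where both are defined. -/
lemma fullRowRank_of_mul_eq_one [Fintype ρ] [DecidableEq ρ] [Fintype γ]
    {A : Matrix ρ γ (RatFunc F)} {B : Matrix γ ρ (RatFunc F)} (hA : DefinedAt A x)
    (hB : DefinedAt B x) (h : A * B = 1) : (evalAt A x).rank = Fintype.card ρ :=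
  rank_eq_card_of_mul_eq_one (by rw [← evalAt_mul hA hB, h, evalAt_one])

end Matrices

/-! ### Equivalence from a completion of `K` to a regular matrix -/

section Completion

variable {n k c : Type*} [Fintype n] [DecidableEq n] [Fintype k] [DecidableEq k] [Fintype c]
  {x : F}

/-- If the completion `[E; K]` of `K` is regular at `x`, then `K` has a right inverse that is
defined at `x`. -/
lemma exists_rightInverse_of_regularAt {E : Matrix n c (RatFunc F)} {K : Matrix k c (RatFunc F)}
    (f : n ⊕ k ≃ c) (h : RegularAt ((Matrix.fromRows E K).submatrix id f) x) :
    ∃ B : Matrix c k (RatFunc F), DefinedAt B x ∧ K * B = 1 := by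
  obtain ⟨S, hS, hTS, -⟩ := h.exists_inv
  refine ⟨S.submatrix f.symm Sum.inr, hS.submatrix _ _, ?_⟩
  have h1 : K * S.submatrix f.symm Sum.inr
      = ((Matrix.fromRows E K).submatrix id f * S).submatrix Sum.inr Sum.inr := by
    ext i j
    simp only [Matrix.mul_apply, Matrix.submatrix_apply, id, Matrix.fromRows_apply_inr]
    rw [← Equiv.sum_comp f]
    simp
  rw [h1, hTS]
  ext i j
  simp [Matrix.one_apply]

/-- The pencil `[M; K]` is equivalent to `diag(G, I)` at `x` as soon as some completion `[E; K]` is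
regular at `x` and some basis `P` of the right null space of `K`, normalized by `E P = d I`,
satisfies `M P = a G`, where `a / d` is a unit at `x`.

Indeed `[M; K] [E; K]⁻¹ = [Y Z; 0 I]` with `Y = (a / d) G`. -/
lemma isExtendedEquivalentAt_fromRows {E M : Matrix n c (RatFunc F)} {K : Matrix k c (RatFunc F)}
    (f : n ⊕ k ≃ c) (hT : RegularAt ((Matrix.fromRows E K).submatrix id f) x)
    (hM : DefinedAt M x) {P : Matrix c n (RatFunc F)} {a d : RatFunc F}
    {G : Matrix n n (RatFunc F)} (hd : d ≠ 0) (hEP : E * P = d • 1) (hKP : K * P = 0)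
    (hMP : M * P = a • G) (had : IsUnitAt (a / d) x) :
    IsExtendedEquivalentAt G (Matrix.fromRows M K) x := by
  set T := (Matrix.fromRows E K).submatrix id f with hTdef
  obtain ⟨S, hS, hTS, hST⟩ := hT.exists_inv
  have hTP : T * P.submatrix f id = Matrix.fromRows (d • 1) 0 := by
    rw [hTdef, Matrix.submatrix_mul_equiv, Matrix.fromRows_mul, hEP, hKP]
    rfl
  -- the first block column of `T⁻¹` is `d⁻¹ P`
  have hS1 : S * (Matrix.fromRows 1 0 : Matrix (n ⊕ k) n (RatFunc F)) = d⁻¹ • P.submatrix f id := by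
    have h1 : S * (T * P.submatrix f id) = P.submatrix f id := by
      rw [← Matrix.mul_assoc, hST, Matrix.one_mul]
    rw [hTP] at h1
    have h2 : (Matrix.fromRows (d • 1) 0 : Matrix (n ⊕ k) n (RatFunc F))
        = d • (Matrix.fromRows 1 0 : Matrix (n ⊕ k) n (RatFunc F)) := by
      ext (i | i) j <;> simp
    rw [h2, Matrix.mul_smul] at h1
    rw [← h1, smul_smul, inv_mul_cancel₀ hd, one_smul]
  set M' := M.submatrix id f with hM'
  set Z := M' * S * (Matrix.fromRows 0 1 : Matrix (n ⊕ k) k (RatFunc F)) with hZ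
  have hY : M' * S * (Matrix.fromRows 1 0 : Matrix (n ⊕ k) n (RatFunc F)) = (a / d) • G := by
    rw [Matrix.mul_assoc, hS1, Matrix.mul_smul, hM', Matrix.submatrix_mul_equiv, hMP]
    ext i j
    simp only [Matrix.smul_apply, Matrix.submatrix_apply, id, smul_eq_mul]
    ring
  have hMS : M' * S = Matrix.fromCols ((a / d) • G) Z := by
    have h1 : (1 : Matrix (n ⊕ k) (n ⊕ k) (RatFunc F))
        = Matrix.fromCols (Matrix.fromRows 1 0) (Matrix.fromRows 0 1) := by
      ext (i | i) (j | j) <;> simp [Matrix.one_apply]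
    calc M' * S = M' * S * 1 := (Matrix.mul_one _).symm
      _ = _ := by rw [h1, Matrix.mul_fromCols, hY]
  have hM'T : M' = Matrix.fromCols ((a / d) • G) Z * T := by
    rw [← hMS, Matrix.mul_assoc, hST, Matrix.mul_one]
  have hK'T : K.submatrix id f = (Matrix.fromCols 0 1 : Matrix k (n ⊕ k) (RatFunc F)) * T := by
    have : T = Matrix.fromRows (E.submatrix id f) (K.submatrix id f) := by
      ext (i | i) j <;> rfl
    rw [this, Matrix.fromCols_mul_fromRows]
    simp
  have hL : (Matrix.fromRows M K).submatrix id f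
      = Matrix.fromBlocks ((a / d) • (1 : Matrix n n (RatFunc F))) Z 0 1
        * Matrix.fromBlocks G 0 0 1 * T := by
    have h1 : (Matrix.fromRows M K).submatrix id f = Matrix.fromRows M' (K.submatrix id f) := by
      ext (i | i) j <;> rfl
    rw [h1, Matrix.fromBlocks_multiply]
    simp only [Matrix.smul_mul, Matrix.one_mul, Matrix.mul_zero, Matrix.mul_one, zero_add,
      add_zero, Matrix.zero_mul]
    rw [← Matrix.fromRows_fromCols_eq_fromBlocks, Matrix.fromRows_mul, ← hM'T, ← hK'T]
  -- transport along `k ≃ Fin (card k)` to the index sets used in the definition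
  let ε : k ≃ Fin (Fintype.card k) := Fintype.equivFin k
  let e : n ⊕ Fin (Fintype.card k) ≃ n ⊕ k := Equiv.sumCongr (Equiv.refl n) ε.symm
  refine ⟨Fintype.card k, 0, e.trans (Equiv.sumEmpty (n ⊕ k) (Fin 0)).symm,
    (e.trans f).trans (Equiv.sumEmpty c (Fin 0)).symm,
    (Matrix.fromBlocks ((a / d) • (1 : Matrix n n (RatFunc F))) Z 0 1).submatrix e e,
    T.submatrix e e, ⟨?_, ?_⟩, ⟨hT.1.submatrix _ _, ?_⟩, ?_⟩
  · have hZd : DefinedAt Z x := by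
      refine ((hM.submatrix _ _).mul hS).mul ?_
      intro i j
      rcases i with i | i
      · exact zero_mem (localRing x)
      · simp only [Matrix.fromRows_apply_inr, Matrix.one_apply]
        split_ifs
        · exact one_mem (localRing x)
        · exact zero_mem (localRing x)
    refine DefinedAt.submatrix ?_ _ _
    rintro (i | i) (j | j)
    · simp only [Matrix.fromBlocks_apply₁₁, Matrix.smul_apply, Matrix.one_apply]
      split_ifs
      · rw [smul_eq_mul, mul_one]
        exact had.1
      · rw [smul_zero]
        exact zero_mem (localRing x)
    · exact hZd i j
    · exact zero_mem (localRing x)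
    · simp only [Matrix.fromBlocks_apply₂₂, Matrix.one_apply]
      split_ifs
      · exact one_mem (localRing x)
      · exact zero_mem (localRing x)
  · have h1 : evalAt ((Matrix.fromBlocks ((a / d) • (1 : Matrix n n (RatFunc F))) Z 0
          (1 : Matrix k k (RatFunc F))).submatrix e e) x
        = (Matrix.fromBlocks (RatFunc.eval (RingHom.id F) x (a / d) • (1 : Matrix n n F))
          (evalAt Z x) 0 (1 : Matrix k k F)).submatrix e e := by
      rw [evalAt, ← Matrix.submatrix_map, Matrix.fromBlocks_map]
      congr 2
      · ext i j
        by_cases h : i = j <;> simp [h]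
      · ext i j
        simp
      · exact evalAt_one
    rw [h1, Matrix.det_submatrix_equiv_self, Matrix.det_fromBlocks_zero₂₁, Matrix.det_smul]
    simpa using pow_ne_zero _ had.2
  · have h1 : evalAt (T.submatrix e e) x = (evalAt T x).submatrix e e := rfl
    rw [h1, Matrix.det_submatrix_equiv_self]
    exact hT.2
  · have h1 : padOne G (Fintype.card k)
        = (Matrix.fromBlocks G 0 0 (1 : Matrix k k (RatFunc F))).submatrix e e := by
      ext (i | i) (j | j) <;> simp [padOne, e, Matrix.one_apply]
    rw [h1, Matrix.submatrix_mul_equiv, Matrix.submatrix_mul_equiv, ← hL]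
    ext i j
    rfl

end Completion

/-! ### The substitution `λ ↦ 1/λ` -/

lemma aeval_X_inv_ne_zero {q : F[X]} (hq : q ≠ 0) :
    eval₂ (algebraMap F (RatFunc F)) (RatFunc.X : RatFunc F)⁻¹ q ≠ 0 := by
  intro h
  have h1 : IsAlgebraic F (RatFunc.X : RatFunc F)⁻¹ := ⟨q, hq, h⟩
  have h2 := h1.inv
  rw [inv_inv] at h2
  exact RatFunc.transcendental_X h2

/-- `substInv` is an endomorphism of the field of rational functions. -/
def substInvHom : RatFunc F →+* RatFunc F where
  toFun := substInv
  map_zero' := RatFunc.eval_zero _ _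
  map_one' := RatFunc.eval_one _ _
  map_add' f g := RatFunc.eval_add _ _ (aeval_X_inv_ne_zero f.denom_ne_zero)
    (aeval_X_inv_ne_zero g.denom_ne_zero)
  map_mul' f g := RatFunc.eval_mul _ _ (aeval_X_inv_ne_zero f.denom_ne_zero)
    (aeval_X_inv_ne_zero g.denom_ne_zero)

lemma substInvHom_algebraMap (q : F[X]) :
    substInvHom (algebraMap F[X] (RatFunc F) q)
      = eval₂ (algebraMap F (RatFunc F)) (RatFunc.X : RatFunc F)⁻¹ q :=
  RatFunc.eval_algebraMap _ _ q

lemma substInvHom_algebraMap_field (c : F) :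
    substInvHom (algebraMap F (RatFunc F) c) = algebraMap F (RatFunc F) c := by
  rw [IsScalarTower.algebraMap_apply F F[X] (RatFunc F), substInvHom_algebraMap,
    Polynomial.algebraMap_eq, eval₂_C, IsScalarTower.algebraMap_apply F F[X] (RatFunc F),
    Polynomial.algebraMap_eq]

lemma revMat_eq {ρ γ : Type*} (g : ℤ) (R : Matrix ρ γ (RatFunc F)) :
    revMat g R = (RatFunc.X : RatFunc F) ^ g • R.map substInvHom := rfl

/-- The `1`-reversal `a + b λ ↦ a λ + b`. -/
def revLin (q : F[X]) : F[X] := C (q.coeff 0) * X + C (q.coeff 1)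

lemma eval_zero_revLin (q : F[X]) : (revLin q).eval 0 = q.coeff 1 := by simp [revLin]

lemma X_mul_substInvHom_algebraMap {q : F[X]} (hq : q.natDegree ≤ 1) :
    RatFunc.X * substInvHom (algebraMap F[X] (RatFunc F) q)
      = algebraMap F[X] (RatFunc F) (revLin q) := by
  have hX := RatFunc.X_ne_zero (K := F)
  conv_lhs => rw [eq_X_add_C_of_natDegree_le_one hq]
  rw [substInvHom_algebraMap, eval₂_add, eval₂_mul, eval₂_C, eval₂_C, eval₂_X, revLin, map_add,
    map_mul, RatFunc.algebraMap_X, RatFunc.algebraMap_C, RatFunc.algebraMap_C,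
    RatFunc.algebraMap_eq_C]
  field_simp
  ring

lemma revMat_one_toRat {ρ γ : Type*} {P : Matrix ρ γ F[X]} (hP : IsPencil P) :
    revMat 1 (toRat P) = toRat (P.map revLin) := by
  ext i j
  rw [revMat_eq, zpow_one]
  exact X_mul_substInvHom_algebraMap (hP i j)

/-! ### Block bidiagonal matrices over a commutative ring -/

section Bidiagonal

variable {R : Type*} [CommRing R] {N p m r : ℕ}

/-- The block bidiagonal matrix with the shape of `lowRankK`, over any commutative ring: block row
`j` has `-h (j - 1)` and `g j` in block columns `j - 1` and `j`, with `Uᵀ` at the change of width.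
Values of `lowRankK` and of its reversal are of this form, and so is `lowRankK` as a rational
matrix. -/
def bidiagonal (N p m r : ℕ) (g h : ℕ → R) (U : Matrix (Fin m) (Fin r) R) :
    Matrix (RowIdx N p m r) (ColIdx N p m r) R :=
  Matrix.fromBlocks
    (Matrix.of fun a c =>
      if a.2 = c.2 then
        if (c.1 : ℕ) = a.1 then -h a.1
        else if (c.1 : ℕ) = a.1 + 1 then g (a.1 + 1) else 0
      else 0)
    0
    (Matrix.of fun a c =>
      if (a.1 : ℕ) = 0 ∧ (c.1 : ℕ) = p then -h p * U c.2 a.2 else 0)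
    (Matrix.of fun a c =>
      if a.2 = c.2 then
        if (c.1 : ℕ) + 1 = a.1 then -h (p + a.1)
        else if c.1 = a.1 then g (p + 1 + a.1) else 0
      else 0)

/-- The block row that selects block column `q ≤ p`. -/
def blockSelector (N p m r : ℕ) (R : Type*) [CommRing R] (q : Fin (p + 1)) :
    Matrix (Fin m) (ColIdx N p m r) R :=
  Matrix.fromCols (Matrix.of fun a c => if c = (q, a) then 1 else 0) 0

lemma lowRankK_map (σ : ℕ → F) (ξ : ℕ → OnePoint F) (β : ℕ → F) (U : Matrix (Fin m) (Fin r) F)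
    (φ : F[X] → R) (ι : F → R) (h0 : φ 0 = 0) (hneg : ∀ q, φ (-q) = -φ q)
    (hmul : ∀ q c, φ (q * C c) = φ q * ι c) :
    (lowRankK N p m r σ ξ β U).map φ
      = bidiagonal N p m r (fun i => φ (gFun ξ β i)) (fun i => φ (hFun σ i)) (U.map ι) := by
  ext (i | i) (j | j) <;>
    simp [lowRankK, bidiagonal, apply_ite φ, h0, hneg, hmul]

lemma bidiagonal_mulVec_inl (g h : ℕ → R) (U : Matrix (Fin m) (Fin r) R)
    (v : ColIdx N p m r → R) (i : Fin p) (a : Fin m) :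
    (bidiagonal N p m r g h U).mulVec v (Sum.inl (i, a))
      = -h i * v (Sum.inl (i.castSucc, a)) + g (i + 1) * v (Sum.inl (i.succ, a)) := by
  rw [Matrix.mulVec, dotProduct,
    Fintype.sum_eq_add (Sum.inl (i.castSucc, a)) (Sum.inl (i.succ, a))]
  · simp [bidiagonal]
  · simp [Fin.ext_iff]
  · rintro (⟨j, b⟩ | ⟨j, b⟩) ⟨h1, h2⟩
    · simp only [ne_eq, Sum.inl.injEq, Prod.mk.injEq, Fin.ext_iff, Fin.val_castSucc,
        Fin.val_succ] at h1 h2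
      simp only [bidiagonal, Matrix.fromBlocks_apply₁₁, Matrix.of_apply, Fin.ext_iff]
      split_ifs <;> first | omega | simp
    · simp [bidiagonal]

lemma bidiagonal_mulVec_inr_zero (g h : ℕ → R) (U : Matrix (Fin m) (Fin r) R)
    (v : ColIdx N p m r → R) (k : Fin (N - 1 - p)) (hk : (k : ℕ) = 0) (s : Fin r) :
    (bidiagonal N p m r g h U).mulVec v (Sum.inr (k, s))
      = -h p * ∑ a, U a s * v (Sum.inl (Fin.last p, a)) + g (p + 1) * v (Sum.inr (k, s)) := by
  rw [Matrix.mulVec, dotProduct, Fintype.sum_sum_type]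
  congr 1
  · rw [Fintype.sum_prod_type, Fintype.sum_eq_single (Fin.last p)]
    · rw [Finset.mul_sum]
      refine Finset.sum_congr rfl fun a _ => ?_
      simp [bidiagonal, hk, mul_assoc]
    · intro j hj
      have : (j : ℕ) ≠ p := fun h => hj (Fin.ext h)
      simp [bidiagonal, this]
  · rw [Fintype.sum_eq_single (k, s)]
    · simp [bidiagonal, hk]
    · rintro ⟨j, b⟩ h1
      simp only [ne_eq, Prod.mk.injEq, Fin.ext_iff] at h1
      simp only [bidiagonal, Matrix.fromBlocks_apply₂₂, Matrix.of_apply, Fin.ext_iff]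
      split_ifs <;> first | omega | simp

lemma bidiagonal_mulVec_inr_succ (g h : ℕ → R) (U : Matrix (Fin m) (Fin r) R)
    (v : ColIdx N p m r → R) (k l : Fin (N - 1 - p)) (hk : (k : ℕ) = l + 1) (s : Fin r) :
    (bidiagonal N p m r g h U).mulVec v (Sum.inr (k, s))
      = -h (p + k) * v (Sum.inr (l, s)) + g (p + 1 + k) * v (Sum.inr (k, s)) := by
  have hkl : k ≠ l := by
    rintro rfl
    omega
  rw [Matrix.mulVec, dotProduct, Fintype.sum_eq_add (Sum.inr (l, s)) (Sum.inr (k, s))]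
  · simp [bidiagonal, hk]
  · simpa using hkl.symm
  · rintro (⟨j, b⟩ | ⟨j, b⟩) ⟨h1, h2⟩
    · simp [bidiagonal, hk]
    · simp only [ne_eq, Sum.inr.injEq, Prod.mk.injEq, Fin.ext_iff] at h1 h2
      simp only [bidiagonal, Matrix.fromBlocks_apply₂₂, Matrix.of_apply, Fin.ext_iff]
      split_ifs <;> first | omega | simp

lemma blockSelector_mulVec (q : Fin (p + 1)) (v : ColIdx N p m r → R) (a : Fin m) :
    (blockSelector N p m r R q).mulVec v a = v (Sum.inl (q, a)) := by
  rw [Matrix.mulVec, dotProduct, Fintype.sum_eq_single (Sum.inl (q, a))]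
  · simp [blockSelector]
  · rintro (c | c) h
    · simp only [ne_eq, Sum.inl.injEq] at h
      simp [blockSelector, h]
    · simp [blockSelector]

/-- A null vector of a block bidiagonal matrix whose block `q ≤ p` vanishes is zero, if the `h j` to
the left and the `g j` to the right of block column `q` are nonzero. -/
lemma eq_zero_of_bidiagonal_mulVec_eq_zero {K : Type*} [Field K] {g h : ℕ → K}
    {U : Matrix (Fin m) (Fin r) K} {q : Fin (p + 1)}
    (hh : ∀ j < (q : ℕ), h j ≠ 0) (hg : ∀ j, (q : ℕ) < j → j ≤ N - 1 → g j ≠ 0) (hpN : p + 2 ≤ N)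
    {v : ColIdx N p m r → K} (hv : (bidiagonal N p m r g h U).mulVec v = 0)
    (hq : ∀ a, v (Sum.inl (q, a)) = 0) : v = 0 := by
  have hrow : ∀ (i : Fin p) a,
      -h i * v (Sum.inl (i.castSucc, a)) + g (i + 1) * v (Sum.inl (i.succ, a)) = 0 := by
    intro i a
    rw [← bidiagonal_mulVec_inl g h U, hv, Pi.zero_apply]
  have hup : ∀ d : ℕ, ∀ j : Fin (p + 1), (j : ℕ) = q + d → ∀ a, v (Sum.inl (j, a)) = 0 := by
    intro d
    induction d with
    | zero =>
      intro j hj a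
      rw [show j = q from Fin.ext hj]
      exact hq a
    | succ d ih =>
      intro j hj a
      have hjp := j.isLt
      have h1 := hrow ⟨q + d, by omega⟩ a
      have e1 : (⟨q + d, by omega⟩ : Fin p).succ = j := Fin.ext (by simp only [Fin.val_succ]; omega)
      rw [ih (Fin.castSucc ⟨q + d, by omega⟩) rfl a, e1, mul_zero, zero_add] at h1
      exact (mul_eq_zero.mp h1).resolve_left (hg _ (by simp only; omega) (by simp only; omega))
  have hdown : ∀ d : ℕ, ∀ j : Fin (p + 1), (j : ℕ) + d = q → ∀ a, v (Sum.inl (j, a)) = 0 := by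
    intro d
    induction d with
    | zero =>
      intro j hj a
      rw [show j = q from Fin.ext hj]
      exact hq a
    | succ d ih =>
      intro j hj a
      have hqp := q.isLt
      have h1 := hrow ⟨j, by omega⟩ a
      have e1 : (⟨j, by omega⟩ : Fin p).castSucc = j := rfl
      rw [ih (Fin.succ ⟨j, by omega⟩) (by simp only [Fin.val_succ]; omega) a, e1, mul_zero,
        add_zero] at h1
      exact (mul_eq_zero.mp h1).resolve_left (neg_ne_zero.mpr (hh _ (by simp only; omega)))
  have hinl : ∀ c, v (Sum.inl c) = 0 := by
    rintro ⟨j, a⟩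
    rcases le_total (q : ℕ) j with hqj | hqj
    · exact hup (j - q) j (by omega) a
    · exact hdown (q - j) j (by omega) a
  have hqp := q.isLt
  have hinr : ∀ d : ℕ, ∀ k : Fin (N - 1 - p), (k : ℕ) = d → ∀ s, v (Sum.inr (k, s)) = 0 := by
    intro d
    induction d with
    | zero =>
      intro k hk s
      have h1 := bidiagonal_mulVec_inr_zero g h U v k hk s
      rw [hv] at h1
      simp only [Pi.zero_apply, hinl, mul_zero, Finset.sum_const_zero, zero_add] at h1
      exact (mul_eq_zero.mp h1.symm).resolve_left (hg _ (by omega) (by omega))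
    | succ d ih =>
      intro k hk s
      have hkN := k.isLt
      have h1 := bidiagonal_mulVec_inr_succ g h U v k ⟨d, by omega⟩ hk s
      rw [hv, ih ⟨d, by omega⟩ rfl, mul_zero, zero_add] at h1
      exact (mul_eq_zero.mp h1.symm).resolve_left (hg _ (by omega) (by omega))
  funext c
  rcases c with c | ⟨k, s⟩
  · exact hinl c
  · exact hinr k k rfl s

/-- Adding `m` rows to `K̃_N` makes it square. -/
def squareEquiv (N p m r : ℕ) : Fin m ⊕ RowIdx N p m r ≃ ColIdx N p m r :=
  Fintype.equivOfCardEq (by simp; ring)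

/-- A polynomial matrix whose value at `x` is block bidiagonal, with nonzero `h j` to the left and
nonzero `g j` to the right of block column `q`, is completed by the selector of block column `q` to
a matrix that is regular at `x`. -/
lemma regularAt_blockSelector {P : Matrix (RowIdx N p m r) (ColIdx N p m r) F[X]} {x : F}
    {g h : ℕ → F} {U : Matrix (Fin m) (Fin r) F} {q : Fin (p + 1)}
    (hP : P.map (eval x) = bidiagonal N p m r g h U) (hpN : p + 2 ≤ N)
    (hh : ∀ j < (q : ℕ), h j ≠ 0) (hg : ∀ j, (q : ℕ) < j → j ≤ N - 1 → g j ≠ 0) :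
    RegularAt ((Matrix.fromRows (blockSelector N p m r (RatFunc F) q) (toRat P)).submatrix id
      (squareEquiv N p m r)) x := by
  have hE : blockSelector N p m r (RatFunc F) q = toRat (blockSelector N p m r F[X] q) := by
    ext a (c | c)
    · simp [blockSelector, toRat, apply_ite (algebraMap F[X] (RatFunc F))]
    · simp [blockSelector, toRat]
  have hE' : (blockSelector N p m r F[X] q).map (eval x) = blockSelector N p m r F q := by
    ext a (c | c)
    · simp [blockSelector, apply_ite (eval x)]
    · simp [blockSelector]
  have hT : (Matrix.fromRows (blockSelector N p m r (RatFunc F) q) (toRat P)).submatrix id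
        (squareEquiv N p m r)
      = toRat ((Matrix.fromRows (blockSelector N p m r F[X] q) P).submatrix id
        (squareEquiv N p m r)) := by
    rw [hE]
    ext (i | i) j <;> rfl
  rw [hT]
  refine ⟨definedAt_toRat _ _, fun hdet => ?_⟩
  rw [evalAt_toRat] at hdet
  obtain ⟨w, hw0, hw⟩ := Matrix.exists_mulVec_eq_zero_iff.mpr hdet
  set v : ColIdx N p m r → F := w ∘ (squareEquiv N p m r).symm with hvdef
  have hTv : (Matrix.fromRows (blockSelector N p m r F q) (bidiagonal N p m r g h U)).mulVec v
      = 0 := by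
    rw [← hE', ← hP, ← hw]
    funext i
    rw [Matrix.mulVec, Matrix.mulVec, dotProduct, dotProduct,
      ← Equiv.sum_comp (squareEquiv N p m r)]
    refine Finset.sum_congr rfl fun j _ => ?_
    rcases i with i | i <;> simp [hvdef]
  rw [Matrix.fromRows_mulVec] at hTv
  have hv0 : v = 0 := by
    refine eq_zero_of_bidiagonal_mulVec_eq_zero hh hg hpN (U := U) ?_ fun a => ?_
    · funext i
      exact congrFun hTv (Sum.inr i)
    · rw [← blockSelector_mulVec q v]
      exact congrFun hTv (Sum.inl a)
  apply hw0
  funext j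
  simpa [hvdef] using congrFun hv0 (squareEquiv N p m r j)

end Bidiagonal

/-! ### The scalar functions -/

section Scalars

variable {N : ℕ} {σ : ℕ → F} {ξ : ℕ → OnePoint F} {β : ℕ → F}

lemma eval_zero_gFun (i : ℕ) : (gFun ξ β i).eval 0 = β i := by
  rcases h : ξ i with _ | y
  · simp [gFun, h, poleFactor]
  · simp [gFun, h, poleFactor]

lemma gFun_ne_zero {i : ℕ} (hβ : β i ≠ 0) : gFun ξ β i ≠ 0 := by
  intro h
  apply hβ
  rw [← eval_zero_gFun (ξ := ξ) (β := β), h, eval_zero]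

lemma eval_gFun_ne_zero {x : F} {i : ℕ} (hx : x ∉ finitePoles N ξ) (h1 : 1 ≤ i) (hN : i ≤ N)
    (hξ : ξ i ≠ OnePoint.some 0) (hβ : β i ≠ 0) : (gFun ξ β i).eval x ≠ 0 := by
  rcases h : ξ i with _ | y
  · simp [gFun, h, poleFactor, hβ]
  · have hy : y ≠ 0 := by
      rintro rfl
      exact hξ h
    have hxy : x ≠ y := by
      rintro rfl
      exact hx ⟨i, h1, hN, h⟩
    simp only [gFun, h, poleFactor, eval_mul, eval_C, eval_sub, eval_one, eval_X]
    refine mul_ne_zero hβ fun h0 => hxy ?_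
    rw [sub_eq_zero, eq_inv_mul_iff_mul_eq₀ hy, mul_one] at h0
    exact h0.symm

lemma natDegree_gFun_le (i : ℕ) : (gFun ξ β i).natDegree ≤ 1 := by
  rcases h : ξ i with _ | y
  · simp [gFun, h, poleFactor]
  · simp only [gFun, h, poleFactor]
    compute_degree

lemma natDegree_hFun_le (i : ℕ) : (hFun σ i).natDegree ≤ 1 := by
  unfold hFun
  compute_degree

lemma coeff_one_hFun (i : ℕ) : (hFun σ i).coeff 1 = 1 := by
  simp [hFun]

lemma coeff_one_gFun_ne_zero {i : ℕ} (hinf : ξ i ≠ OnePoint.infty)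
    (hξ : ξ i ≠ OnePoint.some 0) (hβ : β i ≠ 0) : (gFun ξ β i).coeff 1 ≠ 0 := by
  rcases h : ξ i with _ | y
  · exact absurd h hinf
  · have hy : y ≠ 0 := by
      rintro rfl
      exact hξ h
    simp [gFun, h, poleFactor, coeff_one, hβ, hy]

lemma bFun_zero : bFun σ ξ β 0 = 1 / algebraMap F (RatFunc F) (β 0) := by
  simp [bFun]

lemma bFun_succ (i : ℕ) : bFun σ ξ β (i + 1) = bFun σ ξ β i *
    (algebraMap F[X] (RatFunc F) (hFun σ i) / algebraMap F[X] (RatFunc F) (gFun ξ β (i + 1))) := by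
  rw [bFun, Finset.prod_Icc_succ_top (by omega), ← mul_assoc]
  rfl

lemma gFun_mul_bFun_succ {i : ℕ} (hβ : β (i + 1) ≠ 0) :
    algebraMap F[X] (RatFunc F) (gFun ξ β (i + 1)) * bFun σ ξ β (i + 1)
      = algebraMap F[X] (RatFunc F) (hFun σ i) * bFun σ ξ β i := by
  have : algebraMap F[X] (RatFunc F) (gFun ξ β (i + 1)) ≠ 0 := by
    simpa using gFun_ne_zero hβ
  rw [bFun_succ]
  field_simp

lemma bFun_mem_localRing {x : F} (hx : x ∉ finitePoles N ξ)
    (hξ : ∀ i, 1 ≤ i → i ≤ N → ξ i ≠ OnePoint.some 0) (hβ : ∀ i, i ≤ N → β i ≠ 0) {i : ℕ}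
    (hi : i ≤ N) : bFun σ ξ β i ∈ localRing x := by
  induction i with
  | zero =>
    rw [bFun_zero, one_div]
    exact (isUnitAt_algebraMap_field (hβ 0 hi)).inv.1
  | succ i ih =>
    rw [bFun_succ, div_eq_mul_inv]
    refine mul_mem (ih (by omega)) (mul_mem (algebraMap_mem_localRing _ _) ?_)
    exact (isUnitAt_algebraMap (eval_gFun_ne_zero hx (by omega) hi (hξ _ (by omega) hi)
      (hβ _ hi))).inv.1

/-! ### Orders at infinity of the scalar functions -/

open Classical in
/-- `1` for `ξ = ∞` and `0` otherwise. -/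
def infinityWeight {F : Type*} (y : OnePoint F) : ℕ := if y = OnePoint.infty then 1 else 0

lemma numInfinitePoles_succ {F : Type*} {ξ : ℕ → OnePoint F} (n : ℕ) :
    numInfinitePoles (n + 1) ξ = numInfinitePoles n ξ + infinityWeight (ξ (n + 1)) := by
  rw [numInfinitePoles, numInfinitePoles, infinityWeight,
    ← Finset.insert_Icc_right_eq_Icc_add_one (by omega), Finset.filter_insert]
  split_ifs
  · rw [Finset.card_insert_of_notMem (by simp)]
  · rfl

lemma numInfinitePoles_eq_of_finite {F : Type*} {ξ : ℕ → OnePoint F} {p n : ℕ} (hpn : p ≤ n)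
    (h : ∀ i, p + 1 ≤ i → i ≤ n → ξ i ≠ OnePoint.infty) :
    numInfinitePoles n ξ = numInfinitePoles p ξ := by
  induction n, hpn using Nat.le_induction with
  | base => rfl
  | succ n hpn ih =>
    rw [numInfinitePoles_succ, ih fun i h1 h2 => h i h1 (by omega), infinityWeight,
      if_neg (h (n + 1) (by omega) le_rfl), add_zero]

/-- `g_i(1/λ)` has a simple pole at `0` if `ξ_i` is finite, and is a nonzero constant otherwise. -/
lemma isUnitAt_substInvHom_gFun {i : ℕ} (hξ : ξ i ≠ OnePoint.some 0) (hβ : β i ≠ 0) :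
    IsUnitAt ((RatFunc.X : RatFunc F) ^ (1 - (infinityWeight (ξ i) : ℤ))
      * substInvHom (algebraMap F[X] (RatFunc F) (gFun ξ β i))) 0 := by
  by_cases h : ξ i = OnePoint.infty
  · have hg : algebraMap F[X] (RatFunc F) (gFun ξ β i) = algebraMap F (RatFunc F) (β i) := by
      rw [gFun, h, show poleFactor OnePoint.infty = (1 : F[X]) from rfl, mul_one,
        RatFunc.algebraMap_C, RatFunc.algebraMap_eq_C]
    rw [hg, substInvHom_algebraMap_field, infinityWeight, if_pos h]
    simpa using isUnitAt_algebraMap_field (x := (0 : F)) hβ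
  · rw [infinityWeight, if_neg h, Nat.cast_zero, sub_zero, zpow_one,
      X_mul_substInvHom_algebraMap (natDegree_gFun_le i)]
    apply isUnitAt_algebraMap
    rw [eval_zero_revLin]
    exact coeff_one_gFun_ne_zero h hξ hβ

/-- `b_i(1/λ)` has at `0` a pole whose order is the number of infinite elements among
`ξ_1, …, ξ_i`. -/
lemma isUnitAt_substInvHom_bFun (hξ : ∀ i, 1 ≤ i → i ≤ N → ξ i ≠ OnePoint.some 0)
    (hβ : ∀ i, i ≤ N → β i ≠ 0) {i : ℕ} (hi : i ≤ N) :
    IsUnitAt ((RatFunc.X : RatFunc F) ^ (numInfinitePoles i ξ : ℤ)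
      * substInvHom (bFun σ ξ β i)) 0 := by
  have hX := RatFunc.X_ne_zero (K := F)
  induction i with
  | zero =>
    rw [bFun_zero, map_div₀, map_one, substInvHom_algebraMap_field, one_div]
    simpa [numInfinitePoles] using (isUnitAt_algebraMap_field (x := (0 : F)) (hβ 0 hi)).inv
  | succ i ih =>
    have hh : IsUnitAt (RatFunc.X * substInvHom (algebraMap F[X] (RatFunc F) (hFun σ i))) 0 := by
      rw [X_mul_substInvHom_algebraMap (natDegree_hFun_le i)]
      apply isUnitAt_algebraMap
      rw [eval_zero_revLin, coeff_one_hFun]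
      exact one_ne_zero
    have h1 := (ih (by omega)).mul
      (hh.div (isUnitAt_substInvHom_gFun (hξ _ (by omega) hi) (hβ _ hi)))
    convert h1 using 1
    rw [bFun_succ, map_mul, map_div₀, numInfinitePoles_succ, Nat.cast_add, zpow_add₀ hX,
      zpow_sub₀ hX, zpow_one]
    have hw := zpow_ne_zero (infinityWeight (ξ (i + 1)) : ℤ) hX
    have hg : substInvHom (algebraMap F[X] (RatFunc F) (gFun ξ β (i + 1))) ≠ 0 := by
      simpa using gFun_ne_zero (hβ _ hi)
    field_simp

end Scalars

/-! ### The null space basis of `K̃_N` -/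

section NullBasis

variable {N p m r : ℕ} {σ : ℕ → F} {ξ : ℕ → OnePoint F} {β : ℕ → F}
  {D : ℕ → Matrix (Fin m) (Fin m) F} {Lt : ℕ → Matrix (Fin m) (Fin r) F}
  {U : Matrix (Fin m) (Fin r) F}

/-- The block column with blocks `b_i I` for `i ≤ p` and `b_i Uᵀ` for `i > p`. -/
def nullBasis (N p m r : ℕ) (b : ℕ → RatFunc F) (U : Matrix (Fin m) (Fin r) F) :
    Matrix (ColIdx N p m r) (Fin m) (RatFunc F) :=
  Matrix.fromRows
    (Matrix.of fun c a => if c.2 = a then b c.1 else 0)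
    (Matrix.of fun c a => b (p + 1 + c.1) * algebraMap F (RatFunc F) (U a c.2))

lemma toRat_lowRankK : toRat (lowRankK N p m r σ ξ β U)
    = bidiagonal N p m r (fun i => algebraMap F[X] (RatFunc F) (gFun ξ β i))
      (fun i => algebraMap F[X] (RatFunc F) (hFun σ i)) (U.map (algebraMap F (RatFunc F))) := by
  refine lowRankK_map σ ξ β U _ _ (map_zero _) (map_neg _) fun q c => ?_
  rw [map_mul, RatFunc.algebraMap_C, RatFunc.algebraMap_eq_C]

lemma blockSelector_mul_nullBasis (b : ℕ → RatFunc F) (q : Fin (p + 1)) :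
    blockSelector N p m r (RatFunc F) q * nullBasis N p m r b U
      = b q • (1 : Matrix (Fin m) (Fin m) (RatFunc F)) := by
  ext a a'
  have := blockSelector_mulVec q (fun c => nullBasis N p m r b U c a') a
  rw [Matrix.mul_apply_eq_vecMul, Matrix.vecMul, dotProduct]
  rw [Matrix.mulVec, dotProduct] at this
  rw [this]
  simp [nullBasis, Matrix.one_apply]

/-- The recursion `g_{i+1} b_{i+1} = h_i b_i` makes each block row of `K̃_N` annihilate the null
basis. -/
lemma lowRankK_mul_nullBasis (hpN : p + 2 ≤ N) (hβ : ∀ i, i ≤ N → β i ≠ 0) :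
    toRat (lowRankK N p m r σ ξ β U) * nullBasis N p m r (bFun σ ξ β) U = 0 := by
  have hrec : ∀ i, i + 1 ≤ N → algebraMap F[X] (RatFunc F) (gFun ξ β (i + 1)) * bFun σ ξ β (i + 1)
      = algebraMap F[X] (RatFunc F) (hFun σ i) * bFun σ ξ β i :=
    fun i hi => gFun_mul_bFun_succ (hβ _ hi)
  rw [toRat_lowRankK]
  ext i a'
  change (bidiagonal N p m r _ _ _).mulVec
    (fun c => nullBasis N p m r (bFun σ ξ β) U c a') i = 0
  rcases i with ⟨i, a⟩ | ⟨k, s⟩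
  · have hi := i.isLt
    rw [bidiagonal_mulVec_inl]
    by_cases h : a = a'
    · simp [nullBasis, h, hrec i (by omega)]
    · simp [nullBasis, h]
  · have hk := k.isLt
    rcases hk0 : (k : ℕ) with _ | l
    · rw [bidiagonal_mulVec_inr_zero _ _ _ _ _ hk0]
      simp only [nullBasis, Matrix.fromRows_apply_inl, Matrix.fromRows_apply_inr, Matrix.of_apply,
        Matrix.map_apply, Fin.val_last, mul_ite, mul_zero, Finset.sum_ite_eq', Finset.mem_univ,
        if_true, hk0, add_zero, ← mul_assoc, hrec p (by omega)]
      ring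
    · rw [bidiagonal_mulVec_inr_succ _ _ _ _ k ⟨l, by omega⟩ hk0]
      have h1 := hrec (p + 1 + l) (by omega)
      simp only [nullBasis, Matrix.fromRows_apply_inr, Matrix.of_apply, hk0]
      rw [show p + (l + 1) = p + 1 + l by omega, show p + 1 + (l + 1) = p + 1 + l + 1 by omega,
        ← mul_assoc, ← mul_assoc, h1]
      ring

lemma lowRankM_mul_nullBasis (hpN : p + 2 ≤ N) (hβ : ∀ i, i ≤ N → β i ≠ 0) :
    toRat (lowRankM N p m r σ ξ β D Lt) * nullBasis N p m r (bFun σ ξ β) U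
      = (algebraMap F[X] (RatFunc F) (gFun ξ β N) / algebraMap F (RatFunc F) (β N))
        • lowRankQ N p m r σ ξ β D Lt U := by
  obtain ⟨n, rfl⟩ : ∃ n, N = p + 1 + n + 1 := ⟨N - p - 2, by omega⟩
  have hrec := gFun_mul_bFun_succ (σ := σ) (ξ := ξ) (hβ (p + 1 + n + 1) le_rfl)
  set N := p + 1 + n + 1 with hN
  set γ := algebraMap F[X] (RatFunc F) (gFun ξ β N) / algebraMap F (RatFunc F) (β N) with hγ
  have hC : ∀ c : F, algebraMap F[X] (RatFunc F) (C c) = algebraMap F (RatFunc F) c := fun c => by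
    rw [RatFunc.algebraMap_C, RatFunc.algebraMap_eq_C]
  ext a a'
  have hn : N - 1 - p = n + 1 := by omega
  have hinl : ∑ c : Fin (p + 1) × Fin m, toRat (lowRankM N p m r σ ξ β D Lt) a (Sum.inl c)
        * nullBasis N p m r (bFun σ ξ β) U (Sum.inl c) a'
      = γ * ∑ i ∈ Finset.range (p + 1),
          bFun σ ξ β i * algebraMap F (RatFunc F) (D i a a') := by
    rw [Fintype.sum_prod_type, Finset.sum_range, Finset.mul_sum]
    refine Finset.sum_congr rfl fun i _ => ?_
    rw [Fintype.sum_eq_single a']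
    · simp only [toRat, lowRankM, nullBasis, Matrix.map_apply, Matrix.fromCols_apply_inl,
        Matrix.fromRows_apply_inl, Matrix.of_apply, map_mul, hC, if_true, hγ, map_inv₀]
      ring
    · intro b hb
      simp [nullBasis, hb]
  -- the last block column contributes the terms `N - 1` and `N`, the latter through
  -- `h_{N-1} b_{N-1} = g_N b_N`
  have hinr : ∑ c : Fin (N - 1 - p) × Fin r, toRat (lowRankM N p m r σ ξ β D Lt) a (Sum.inr c)
        * nullBasis N p m r (bFun σ ξ β) U (Sum.inr c) a'
      = γ * ∑ k ∈ Finset.range (n + 2), bFun σ ξ β (p + 1 + k)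
          * algebraMap F (RatFunc F) ((Lt (p + 1 + k) * U.transpose) a a') := by
    have hterm : ∀ k : Fin (N - 1 - p),
        ∑ s, toRat (lowRankM N p m r σ ξ β D Lt) a (Sum.inr (k, s))
          * nullBasis N p m r (bFun σ ξ β) U (Sum.inr (k, s)) a'
        = γ * (bFun σ ξ β (p + 1 + k)
            * algebraMap F (RatFunc F) ((Lt (p + 1 + k) * U.transpose) a a'))
          + if (k : ℕ) = n then γ * (bFun σ ξ β N
            * algebraMap F (RatFunc F) ((Lt N * U.transpose) a a')) else 0 := by
      intro k
      have hγN : γ * bFun σ ξ β N = (algebraMap F (RatFunc F) (β N))⁻¹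
          * (algebraMap F[X] (RatFunc F) (hFun σ (p + 1 + n)) * bFun σ ξ β (p + 1 + n)) := by
        rw [← hrec, hγ]
        ring
      simp only [Matrix.mul_apply, Matrix.transpose_apply, map_sum, map_mul]
      split_ifs with hk
      · rw [← mul_assoc γ (bFun σ ξ β N), hγN]
        simp only [Finset.mul_sum, ← Finset.sum_add_distrib]
        refine Finset.sum_congr rfl fun s _ => ?_
        have h1 : p + 1 + n = N - 1 := by omega
        simp only [toRat, lowRankM, nullBasis, Matrix.map_apply, Matrix.fromCols_apply_inr,
          Matrix.fromRows_apply_inr, Matrix.of_apply, map_add, map_mul, hC, hk, h1, if_true,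
          hγ, map_inv₀]
        ring
      · simp only [Finset.mul_sum, add_zero]
        refine Finset.sum_congr rfl fun s _ => ?_
        have h1 : ¬ (p + 1 + (k : ℕ) = N - 1) := by omega
        simp only [toRat, lowRankM, nullBasis, Matrix.map_apply, Matrix.fromCols_apply_inr,
          Matrix.fromRows_apply_inr, Matrix.of_apply, map_mul, hC, h1, if_false, add_zero,
          hγ, map_inv₀]
        ring
    rw [Fintype.sum_prod_type, Finset.sum_congr rfl fun k _ => hterm k]
    refine (Fin.sum_univ_eq_sum_range (fun k : ℕ => γ * (bFun σ ξ β (p + 1 + k)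
        * algebraMap F (RatFunc F) ((Lt (p + 1 + k) * U.transpose) a a'))
      + if k = n then γ * (bFun σ ξ β N
        * algebraMap F (RatFunc F) ((Lt N * U.transpose) a a')) else 0) _).trans ?_
    rw [hn, Finset.sum_add_distrib, Finset.sum_ite_eq', if_pos (by simp),
      Finset.sum_range_succ _ (n + 1), mul_add, Finset.mul_sum]
    rfl
  rw [Matrix.mul_apply, Fintype.sum_sum_type, hinl, hinr, ← mul_add, Matrix.smul_apply, smul_eq_mul]
  congr 1
  rw [lowRankQ, Matrix.add_apply, Matrix.sum_apply, Matrix.sum_apply]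
  congr 1
  · rw [← Nat.range_succ_eq_Icc_zero]
    rfl
  · rw [← Finset.Ico_add_one_right_eq_Icc, Finset.sum_Ico_eq_sum_range,
      show N + 1 - (p + 1) = n + 2 by omega]
    rfl

end NullBasis

/-! ### Pencils with empty state matrix -/

section EmptyState

variable {q c : Type*} {L : Matrix q c F[X]}

lemma isLinearSystemMatrix_empty (hL : IsPencil L) :
    IsLinearSystemMatrix (0 : Matrix (Fin 0) (Fin 0) F[X]) (0 : Matrix (Fin 0) c F[X])
      (0 : Matrix q (Fin 0) F[X]) L := by
  refine ⟨?_, by simp⟩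
  rintro (i | i) (j | j)
  · exact i.elim0
  · exact i.elim0
  · exact j.elim0
  · exact hL i j

lemma isMinimalAt_empty [Fintype q] [Fintype c]
    (A : Matrix (Fin 0) (Fin 0) (RatFunc F)) (B : Matrix (Fin 0) c (RatFunc F))
    (C : Matrix q (Fin 0) (RatFunc F)) (x : F) : IsMinimalAt A B C x :=
  ⟨le_antisymm (Matrix.rank_le_card_width _) (by simp),
    le_antisymm (Matrix.rank_le_card_height _) (by simp)⟩

lemma transferFunction_empty :
    transferFunction (0 : Matrix (Fin 0) (Fin 0) F[X]) (0 : Matrix (Fin 0) c F[X])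
      (0 : Matrix q (Fin 0) F[X]) L = toRat L := by
  ext i j
  simp [transferFunction]

lemma matDegree_empty [Fintype q] [Fintype c] (hL : IsPencil L)
    {i : q} {j : c} (hij : (L i j).natDegree = 1) :
    matDegree (systemMatrix (0 : Matrix (Fin 0) (Fin 0) F[X]) (0 : Matrix (Fin 0) c F[X])
      (0 : Matrix q (Fin 0) F[X]) L) = 1 := by
  apply le_antisymm
  · exact Finset.sup_le fun i _ => Finset.sup_le fun j _ => (isLinearSystemMatrix_empty hL).1 i j
  · refine le_trans hij.ge ?_
    refine le_trans ?_ (Finset.le_sup (Finset.mem_univ (Sum.inr i : Fin 0 ⊕ q)))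
    exact Finset.le_sup (f := fun j => (systemMatrix (0 : Matrix (Fin 0) (Fin 0) F[X])
      (0 : Matrix (Fin 0) c F[X]) (0 : Matrix q (Fin 0) F[X]) L (Sum.inr i) j).natDegree)
      (Finset.mem_univ (Sum.inr j : Fin 0 ⊕ c))

end EmptyState

/-! ### The low rank pencil -/

section LowRank

variable {N p m r : ℕ} {σ : ℕ → F} {ξ : ℕ → OnePoint F} {β : ℕ → F}
  {D : ℕ → Matrix (Fin m) (Fin m) F} {Lt : ℕ → Matrix (Fin m) (Fin r) F}
  {U : Matrix (Fin m) (Fin r) F}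

lemma isPencil_lowRankL : IsPencil (lowRankL N p m r σ ξ β D Lt U) := by
  have hmul : ∀ (q : F[X]) (a b : F), q.natDegree ≤ 1 → (C a * q * C b).natDegree ≤ 1 :=
    fun q a b hq => (natDegree_mul_C_le _ _).trans ((natDegree_C_mul_le _ _).trans hq)
  have hg := natDegree_gFun_le (ξ := ξ) (β := β)
  have hh := natDegree_hFun_le (σ := σ)
  rintro (a | a | a) (c | c) <;>
    simp only [lowRankL, lowRankM, lowRankK, Matrix.fromRows_apply_inl, Matrix.fromRows_apply_inr,
      Matrix.fromCols_apply_inl, Matrix.fromCols_apply_inr, Matrix.fromBlocks_apply₁₁,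
      Matrix.fromBlocks_apply₁₂, Matrix.fromBlocks_apply₂₁, Matrix.fromBlocks_apply₂₂,
      Matrix.of_apply, Matrix.zero_apply, natDegree_zero, zero_le]
  · exact hmul _ _ _ (hg _)
  · refine natDegree_add_le_of_degree_le (hmul _ _ _ (hg _)) ?_
    split_ifs
    · exact hmul _ _ _ (hh _)
    · simp
  · split_ifs <;> simp [hg, hh]
  · split_ifs
    · exact (natDegree_mul_C_le _ _).trans (by simp [hh])
    · simp
  · split_ifs <;> simp [hg, hh]

lemma regularAt_lowRankK {x : F} (hpN : p + 2 ≤ N)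
    (hξ : ∀ i, 1 ≤ i → i ≤ N → ξ i ≠ OnePoint.some 0) (hβ : ∀ i, i ≤ N → β i ≠ 0)
    (hx : x ∉ finitePoles N ξ) :
    RegularAt ((Matrix.fromRows (blockSelector N p m r (RatFunc F) 0)
      (toRat (lowRankK N p m r σ ξ β U))).submatrix id (squareEquiv N p m r)) x := by
  refine regularAt_blockSelector (lowRankK_map σ ξ β U (eval x) id eval_zero
    (fun _ => eval_neg _ _) fun q c => by simp) hpN (fun j hj => by simp at hj) fun j h1 h2 => ?_
  have h1' : 1 ≤ j := h1
  exact eval_gFun_ne_zero hx h1' (by omega) (hξ j h1' (by omega)) (hβ j (by omega))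

/-- At infinity the block columns to the left of the `p`-th have the pivots `-h_j`, whose reversals
do not vanish at `0`, so no condition on `ξ_1, …, ξ_p` is needed. -/
lemma regularAt_revLin_lowRankK (hpN : p + 2 ≤ N)
    (hξ : ∀ i, 1 ≤ i → i ≤ N → ξ i ≠ OnePoint.some 0) (hβ : ∀ i, i ≤ N → β i ≠ 0)
    (hfin : ∀ i, p + 1 ≤ i → i ≤ N - 1 → ξ i ≠ OnePoint.infty) :
    RegularAt ((Matrix.fromRows (blockSelector N p m r (RatFunc F) (Fin.last p))
      (toRat ((lowRankK N p m r σ ξ β U).map revLin))).submatrix id (squareEquiv N p m r)) 0 := by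
  have h1 : ((lowRankK N p m r σ ξ β U).map revLin).map (eval 0)
      = (lowRankK N p m r σ ξ β U).map fun q => q.coeff 1 := by
    ext i j
    exact eval_zero_revLin _
  refine regularAt_blockSelector (h1.trans (lowRankK_map σ ξ β U (fun q => q.coeff 1) id
    (coeff_zero 1) (fun _ => coeff_neg _ _) fun q c => coeff_mul_C _ _ _)) hpN (fun j _ => ?_)
    fun j h1 h2 => ?_
  · simp [coeff_one_hFun]
  · have h1' : p + 1 ≤ j := h1
    exact coeff_one_gFun_ne_zero (hfin j h1' h2) (hξ j (by omega) (by omega)) (hβ j (by omega))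

lemma definedAt_nullBasis {x : F} (hpN : p + 2 ≤ N)
    (hξ : ∀ i, 1 ≤ i → i ≤ N → ξ i ≠ OnePoint.some 0) (hβ : ∀ i, i ≤ N → β i ≠ 0)
    (hx : x ∉ finitePoles N ξ) : DefinedAt (nullBasis N p m r (bFun σ ξ β) U) x := by
  rintro (⟨i, a⟩ | ⟨k, s⟩) a'
  · have hi := i.isLt
    simp only [nullBasis, Matrix.fromRows_apply_inl, Matrix.of_apply]
    split_ifs
    · exact bFun_mem_localRing hx hξ hβ (by omega)
    · exact zero_mem (localRing x)
  · have hk := k.isLt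
    refine mul_mem (S := Subring (RatFunc F)) (s := localRing x)
      (bFun_mem_localRing hx hξ hβ (by omega)) ?_
    rw [IsScalarTower.algebraMap_apply F F[X] (RatFunc F)]
    exact algebraMap_mem_localRing _ _

lemma definedAt_smul {ρ γ : Type*} {R : Matrix ρ γ (RatFunc F)} {x : F} {f : RatFunc F}
    (hf : f ∈ localRing x) (hR : DefinedAt R x) : DefinedAt (f • R) x :=
  fun i j => (localRing x).mul_mem hf (hR i j)

lemma infinite_compl_finitePoles {F : Type*} [Infinite F] (N : ℕ) (ξ : ℕ → OnePoint F) :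
    (finitePoles N ξ)ᶜ.Infinite := by
  apply Set.Finite.infinite_compl
  refine (((Set.finite_Icc 1 N).image ξ).preimage
    (f := fun x : F => (OnePoint.some x : OnePoint F)) ?_).subset ?_
  · exact OnePoint.coe_injective.injOn
  · rintro x ⟨k, h1, hN, hk⟩
    exact ⟨k, ⟨h1, hN⟩, hk⟩

lemma isBlockFullRankPencilAssociatedIn_lowRankL [Infinite F] (hpN : p + 2 ≤ N)
    (hξ : ∀ i, 1 ≤ i → i ≤ N → ξ i ≠ OnePoint.some 0) (hβ : ∀ i, i ≤ N → β i ≠ 0) :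
    IsBlockFullRankPencilAssociatedIn (lowRankL N p m r σ ξ β D Lt U)
      (Equiv.refl (Fin m ⊕ RowIdx N p m r)) (Equiv.sumEmpty (ColIdx N p m r) (Fin 0)).symm
      (lowRankM N p m r σ ξ β D Lt) (lowRankK N p m r σ ξ β U)
      (0 : Matrix (Fin 0) (Fin m) F[X]) (lowRankQ N p m r σ ξ β D Lt U) (finitePoles N ξ)ᶜ := by
  obtain ⟨y, hy⟩ := (infinite_compl_finitePoles N ξ).nonempty
  have hK : ∀ x ∉ finitePoles N ξ, ∃ B : Matrix (ColIdx N p m r) (RowIdx N p m r) (RatFunc F),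
      DefinedAt B x ∧ toRat (lowRankK N p m r σ ξ β U) * B = 1 := fun x hx =>
    exists_rightInverse_of_regularAt _ (regularAt_lowRankK hpN hξ hβ hx)
  have hKn : HasFullRowNormalRank (toRat (lowRankK N p m r σ ξ β U)) := by
    obtain ⟨B, -, hB⟩ := hK y hy
    exact rank_eq_card_of_mul_eq_one hB
  have hK₂ : HasFullRowNormalRank (toRat (0 : Matrix (Fin 0) (Fin m) F[X])) :=
    le_antisymm (Matrix.rank_le_card_height _) (by simp)
  set u : RatFunc F := algebraMap F (RatFunc F) (β N) / algebraMap F[X] (RatFunc F) (gFun ξ β N)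
    with hu
  set P := nullBasis N p m r (bFun σ ξ β) U with hP
  have huunit : ∀ x ∉ finitePoles N ξ, IsUnitAt u x := fun x hx =>
    (isUnitAt_algebraMap_field (hβ N le_rfl)).div (isUnitAt_algebraMap
      (eval_gFun_ne_zero hx (by omega) le_rfl (hξ N (by omega) le_rfl) (hβ N le_rfl)))
  have hb0 : ∀ x, IsUnitAt (bFun σ ξ β 0) x := fun x => by
    rw [bFun_zero, one_div]
    exact (isUnitAt_algebraMap_field (hβ 0 (by omega))).inv
  -- selecting the first block column of the dual basis inverts it up to the unit `u b₀`
  set B : Matrix (ColIdx N p m r) (Fin m) (RatFunc F) :=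
    (u * bFun σ ξ β 0)⁻¹ • (blockSelector N p m r (RatFunc F) 0).transpose with hB
  have hNB : (u • P).transpose * B = 1 := by
    have h1 := congrArg Matrix.transpose
      (blockSelector_mul_nullBasis (N := N) (r := r) (U := U) (bFun σ ξ β) (0 : Fin (p + 1)))
    rw [Matrix.transpose_mul, Matrix.transpose_smul, Matrix.transpose_one] at h1
    rw [hB, Matrix.transpose_smul, Matrix.mul_smul, Matrix.smul_mul, h1, smul_smul, smul_smul]
    have h2 : (u * bFun σ ξ β 0)⁻¹ * (u * bFun σ ξ β ((0 : Fin (p + 1)) : ℕ)) = 1 :=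
      inv_mul_cancel₀ (mul_ne_zero (huunit y hy).ne_zero (hb0 y).ne_zero)
    rw [mul_assoc, h2, one_smul]
  have hBx : ∀ x ∉ finitePoles N ξ, DefinedAt B x := fun x hx => by
    refine definedAt_smul ((huunit x hx).mul (hb0 x)).inv.1 ?_
    rintro (c | c) a
    · simp only [blockSelector, Matrix.transpose_apply, Matrix.fromCols_apply_inl,
        Matrix.of_apply]
      split_ifs
      · exact one_mem (localRing x)
      · exact zero_mem (localRing x)
    · exact zero_mem (localRing x)
  have hNx : ∀ x ∉ finitePoles N ξ, DefinedAt (u • P).transpose x := fun x hx i j =>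
    definedAt_smul (huunit x hx).1 (definedAt_nullBasis hpN hξ hβ hx) j i
  refine ⟨⟨?_, isPencil_lowRankL, hKn, hK₂⟩, ⟨y, hy⟩, (u • P).transpose, 1,
    ⟨hKn, rank_eq_card_of_mul_eq_one hNB, ?_, ?_⟩, ⟨hK₂, Matrix.rank_one, by simp, ?_⟩,
    fun x hx => ⟨definedAt_toRat _ _, ?_⟩,
    fun x _ => ⟨definedAt_toRat _ _, le_antisymm (Matrix.rank_le_card_height _) (by simp)⟩,
    fun x hx => ⟨hNx x hx, fullRowRank_of_mul_eq_one (hNx x hx) (hBx x hx) hNB⟩,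
    fun x _ => ⟨?_, ?_⟩, ?_⟩
  · ext (i | i) (j | j)
    · rfl
    · exact j.elim0
    · rfl
    · exact j.elim0
  · rw [add_comm, ← Fintype.card_sum]
    exact Fintype.card_congr (squareEquiv N p m r)
  · rw [Matrix.transpose_transpose, Matrix.mul_smul, hP, lowRankK_mul_nullBasis hpN hβ, smul_zero]
  · ext i
    exact i.elim0
  · obtain ⟨B, hBd, hB⟩ := hK x hx
    exact fullRowRank_of_mul_eq_one (definedAt_toRat _ _) hBd hB
  · intro i j
    rw [Matrix.one_apply]
    split_ifs
    · exact one_mem (localRing x)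
    · exact zero_mem (localRing x)
  · rw [evalAt_one, Matrix.rank_one]
  · rw [Matrix.transpose_transpose, Matrix.one_mul, Matrix.mul_smul, hP,
      lowRankM_mul_nullBasis hpN hβ, smul_smul, hu]
    have h1 : algebraMap F[X] (RatFunc F) (gFun ξ β N) ≠ 0 := by
      simpa using gFun_ne_zero (hβ N le_rfl)
    have h2 : algebraMap F (RatFunc F) (β N) ≠ 0 := by
      simpa using hβ N le_rfl
    rw [div_mul_div_cancel₀ h1, div_self h2, one_smul]

lemma isLinearizationEmptyStateIn_lowRankL [Infinite F] (hpN : p + 2 ≤ N)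
    (hξ : ∀ i, 1 ≤ i → i ≤ N → ξ i ≠ OnePoint.some 0) (hβ : ∀ i, i ≤ N → β i ≠ 0) :
    IsLinearizationEmptyStateIn (lowRankL N p m r σ ξ β D Lt U)
      (lowRankQ N p m r σ ξ β D Lt U) (finitePoles N ξ)ᶜ := by
  refine ⟨(infinite_compl_finitePoles N ξ).nonempty, fun x hx =>
    ⟨isLinearSystemMatrix_empty isPencil_lowRankL, isMinimalAt_empty _ _ _ _, ?_⟩⟩
  have hb0 : IsUnitAt (bFun σ ξ β ((0 : Fin (p + 1)) : ℕ)) x := by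
    rw [Fin.val_zero, bFun_zero, one_div]
    exact (isUnitAt_algebraMap_field (hβ 0 (by omega))).inv
  have hL : toRat (lowRankL N p m r σ ξ β D Lt U)
      = Matrix.fromRows (toRat (lowRankM N p m r σ ξ β D Lt))
        (toRat (lowRankK N p m r σ ξ β U)) := by
    ext (i | i) j <;> rfl
  rw [transferFunction_empty, hL]
  refine isExtendedEquivalentAt_fromRows _ (regularAt_lowRankK hpN hξ hβ hx)
    (definedAt_toRat _ _) hb0.ne_zero (blockSelector_mul_nullBasis _ _)
    (lowRankK_mul_nullBasis hpN hβ) (lowRankM_mul_nullBasis hpN hβ) (IsUnitAt.div ?_ hb0)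
  exact (isUnitAt_algebraMap (eval_gFun_ne_zero hx (by omega) le_rfl (hξ N (by omega) le_rfl)
    (hβ N le_rfl))).div (isUnitAt_algebraMap_field (hβ N le_rfl))

/-- The entry `g_{p+1}` of the pencil has degree one when `ξ_{p+1}` is finite. -/
lemma matDegree_lowRankL (hpN : p + 2 ≤ N) (hr : 0 < r)
    (hξ : ∀ i, 1 ≤ i → i ≤ N → ξ i ≠ OnePoint.some 0) (hβ : ∀ i, i ≤ N → β i ≠ 0)
    (hfin : ∀ i, p + 1 ≤ i → i ≤ N - 1 → ξ i ≠ OnePoint.infty) :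
    matDegree (systemMatrix (0 : Matrix (Fin 0) (Fin 0) F[X])
      (0 : Matrix (Fin 0) (ColIdx N p m r) F[X])
      (0 : Matrix (Fin m ⊕ RowIdx N p m r) (Fin 0) F[X]) (lowRankL N p m r σ ξ β D Lt U)) = 1 := by
  let k : Fin (N - 1 - p) := ⟨0, by omega⟩
  let s : Fin r := ⟨0, hr⟩
  refine matDegree_empty isPencil_lowRankL (i := Sum.inr (Sum.inr (k, s)))
    (j := Sum.inr (k, s)) (le_antisymm (isPencil_lowRankL _ _) ?_)
  have h1 : lowRankL N p m r σ ξ β D Lt U (Sum.inr (Sum.inr (k, s))) (Sum.inr (k, s))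
      = gFun ξ β (p + 1) := by
    simp [lowRankL, lowRankK, k]
  rw [h1]
  exact le_natDegree_of_ne_zero (coeff_one_gFun_ne_zero (hfin _ le_rfl (by omega))
    (hξ _ (by omega) (by omega)) (hβ _ (by omega)))

lemma isLinearizationEmptyStateAtInfinity_lowRankL (hpN : p + 2 ≤ N) (hr : 0 < r)
    (hξ : ∀ i, 1 ≤ i → i ≤ N → ξ i ≠ OnePoint.some 0) (hβ : ∀ i, i ≤ N → β i ≠ 0)
    (hfin : ∀ i, p + 1 ≤ i → i ≤ N - 1 → ξ i ≠ OnePoint.infty) :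
    IsLinearizationEmptyStateAtInfinity (lowRankL N p m r σ ξ β D Lt U)
      (lowRankQ N p m r σ ξ β D Lt U) (numInfinitePoles N ξ : ℤ) := by
  refine ⟨isLinearSystemMatrix_empty isPencil_lowRankL, isMinimalAt_empty _ _ _ _, ?_⟩
  rw [matDegree_lowRankL hpN hr hξ hβ hfin, transferFunction_empty, Nat.cast_one]
  have hX := RatFunc.X_ne_zero (K := F)
  set M := lowRankM N p m r σ ξ β D Lt with hM
  set K := lowRankK N p m r σ ξ β U with hK
  set Q := lowRankQ N p m r σ ξ β D Lt U with hQ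
  set P := nullBasis N p m r (bFun σ ξ β) U with hP
  set γ : RatFunc F := algebraMap F[X] (RatFunc F) (gFun ξ β N) / algebraMap F (RatFunc F) (β N)
    with hγ
  have hMp : IsPencil M := fun i j => isPencil_lowRankL (U := U) (Sum.inl i) j
  have hKp : IsPencil K := fun i j => isPencil_lowRankL (D := D) (Lt := Lt) (Sum.inr i) j
  have hL : revMat 1 (toRat (lowRankL N p m r σ ξ β D Lt U))
      = Matrix.fromRows (toRat (M.map revLin)) (toRat (K.map revLin)) := by
    rw [revMat_one_toRat isPencil_lowRankL]
    ext (i | i) j <;> rfl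
  have hMP : toRat (M.map revLin) * P.map substInvHom
      = (RatFunc.X ^ (1 - (numInfinitePoles N ξ : ℤ)) * substInvHom γ)
        • revMat (numInfinitePoles N ξ : ℤ) Q := by
    rw [← revMat_one_toRat hMp, revMat_eq, revMat_eq, Matrix.smul_mul, ← Matrix.map_mul,
      lowRankM_mul_nullBasis hpN hβ, smul_smul, mul_right_comm, ← zpow_add₀ hX, sub_add_cancel]
    ext i j
    simp only [Matrix.smul_apply, Matrix.map_apply, smul_eq_mul, map_mul, zpow_one, mul_assoc,
      ← hγ, ← hQ]
  have hKP : toRat (K.map revLin) * P.map substInvHom = 0 := by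
    rw [← revMat_one_toRat hKp, revMat_eq, Matrix.smul_mul, ← Matrix.map_mul,
      lowRankK_mul_nullBasis hpN hβ, Matrix.map_zero _ (map_zero _), smul_zero]
  have hEP : blockSelector N p m r (RatFunc F) (Fin.last p) * P.map substInvHom
      = substInvHom (bFun σ ξ β p) • (1 : Matrix (Fin m) (Fin m) (RatFunc F)) := by
    have hP' : P.map substInvHom = nullBasis N p m r (fun i => substInvHom (bFun σ ξ β i)) U := by
      ext (c | c) a
      · simp [hP, nullBasis, apply_ite substInvHom]
      · simp [hP, nullBasis, -RatFunc.algebraMap_eq_C, substInvHom_algebraMap_field]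
    rw [hP', blockSelector_mul_nullBasis]
    rfl
  have hbp := isUnitAt_substInvHom_bFun hξ hβ (σ := σ) (show p ≤ N by omega)
  have hbp0 : substInvHom (bFun σ ξ β p) ≠ 0 := right_ne_zero_of_mul hbp.ne_zero
  rw [hL]
  refine isExtendedEquivalentAt_fromRows _ (regularAt_revLin_lowRankK hpN hξ hβ hfin)
    (definedAt_toRat _ _) hbp0 hEP hKP hMP ?_
  -- all infinite poles are among `ξ_1, …, ξ_p` and `ξ_N`: the orders of `b_p` and `g_N` at
  -- infinity add up to the grade
  have hcount : numInfinitePoles N ξ = numInfinitePoles p ξ + infinityWeight (ξ N) := by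
    obtain ⟨n, rfl⟩ : ∃ n, N = n + 1 := ⟨N - 1, by omega⟩
    rw [numInfinitePoles_succ, numInfinitePoles_eq_of_finite (n := n) (by omega) hfin]
  have hg := (isUnitAt_substInvHom_gFun (hξ N (by omega) le_rfl) (hβ N le_rfl)).div
    (isUnitAt_algebraMap_field (x := (0 : F)) (hβ N le_rfl))
  convert hg.div hbp using 1
  rw [hγ, map_div₀, substInvHom_algebraMap_field, hcount, Nat.cast_add, zpow_sub₀ hX, zpow_sub₀ hX,
    zpow_add₀ hX]
  field_simp

end LowRank

end

end NLEIGS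

theorem theorem6p2 {F : Type*} [Field F] [IsAlgClosed F] (N p m r : ℕ)
    (hpN : p + 2 ≤ N) (hr : 0 < r)
    (σ : ℕ → F) (ξ : ℕ → OnePoint F) (β : ℕ → F)
    (hξ : ∀ i, 1 ≤ i → i ≤ N → ξ i ≠ OnePoint.some 0)
    (hβ : ∀ i, i ≤ N → β i ≠ 0)
    (D : ℕ → Matrix (Fin m) (Fin m) F) (Lt : ℕ → Matrix (Fin m) (Fin r) F)
    (U : Matrix (Fin m) (Fin r) F) :
    NLEIGS.IsBlockFullRankPencilAssociatedIn (NLEIGS.lowRankL N p m r σ ξ β D Lt U)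
        (Equiv.refl (Fin m ⊕ NLEIGS.RowIdx N p m r))
        (Equiv.sumEmpty (NLEIGS.ColIdx N p m r) (Fin 0)).symm
        (NLEIGS.lowRankM N p m r σ ξ β D Lt) (NLEIGS.lowRankK N p m r σ ξ β U)
        (0 : Matrix (Fin 0) (Fin m) (Polynomial F))
        (NLEIGS.lowRankQ N p m r σ ξ β D Lt U) (NLEIGS.finitePoles N ξ)ᶜ ∧
      NLEIGS.IsLinearizationEmptyStateIn (NLEIGS.lowRankL N p m r σ ξ β D Lt U)
        (NLEIGS.lowRankQ N p m r σ ξ β D Lt U) (NLEIGS.finitePoles N ξ)ᶜ ∧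
      ((∀ i, p + 1 ≤ i → i ≤ N - 1 → ξ i ≠ OnePoint.infty) →
        NLEIGS.IsLinearizationEmptyStateAtInfinity (NLEIGS.lowRankL N p m r σ ξ β D Lt U)
          (NLEIGS.lowRankQ N p m r σ ξ β D Lt U) (NLEIGS.numInfinitePoles N ξ : ℤ)) := by
  have : Infinite F := IsAlgClosed.instInfinite
  exact ⟨NLEIGS.isBlockFullRankPencilAssociatedIn_lowRankL hpN hξ hβ,
    NLEIGS.isLinearizationEmptyStateIn_lowRankL hpN hξ hβ,
    NLEIGS.isLinearizationEmptyStateAtInfinity_lowRankL hpN hr hξ hβ⟩
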